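/- Let $n,k,k'\ge 0$ be integers, $\delta,\delta'\in\mathbb R$, and let $(p_1,\dots,p_n,q^1,\dots,q^n,t)$ be the coordinates of $\mathbb R^{2n+1}$, $\mathcal E_s=\sum_j(p_j\partial_{p_j}+q^j\partial_{q^j})$. For $h\in C^\infty(\mathbb R^{2n+1})$ let $$X_h=\sum_j(\partial_{p_j}h\,\partial_{q^j}-\partial_{q^j}h\,\partial_{p_j})+\mathcal E_s(h)\,\partial_t-\partial_t h\,\mathcal E_s-2h\,\partial_t$$ be its contact Hamiltonian vector field, and let $\mathrm{sp}_{2n+2}$ be the Lie algebra of the fields $X_h$ with $h$ a polynomial of degree at most $2$. Let $R^k_\delta=\mathcal S^k_{\delta+k/(n+1)}(\mathbb R^{2n+1})$ be the space of symmetric contravariant tensor fields of degree $k$ with values in densities of weight $w=\delta+\frac{k}{n+1}$, i.e. of polynomials $P(\xi)$, homogeneous of degree $k$ in the fibre variables $\xi=(\xi_{p_j},\xi_{q^j},\xi_t)$, with coefficients in $C^\infty(\mathbb R^{2n+1})$, on which a vector field $V$ acts by $$L_VP=V(P)-\sum_{i,j}\partial_jV^i\,\xi_i\,\partial_{\xi_j}P+w\sum_i\partial_iV^i\,P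 .$$ Let $C^k_\delta$ be the Casimir operator of this representation of $\mathrm{sp}_{2n+2}$ on $R^k_\delta$ with respect to the Killing form. Let $i_\alpha:R^k_\delta\to R^{k-1}_\delta$ and $X:R^k_\delta\to R^{k+1}_\delta$ be the operators $$i_\alpha=\tfrac12\Big(\sum_j(p_j\partial_{\xi_{q^j}}-q^j\partial_{\xi_{p_j}})-\partial_{\xi_t}\Big),$$ $$X=\sum_j(\xi_{q^j}\partial_{p_j}-\xi_{p_j}\partial_{q^j})+\xi_t\,\mathcal E_s-\sum_j(p_j\xi_{p_j}+q^j\xi_{q^j})\,\partial_t+(2(n+1)w-k)\,\xi_t ,$$ and put $R^{k,\ell}_\delta=X^\ell(R^{k-\ell}_\delta\cap\ker i_\alpha)$ for $0\le\ell\le k$, and $$\varepsilon^{k,\ell}_\delta=\tfrac1{n+2}\Big((n+1)^2\delta^2-(n+1)^2\delta+k(n+1)\delta+\tfrac{k^2-k}2-\tfrac{\ell}{2}\big(2(n+1)\delta+2(k-\ell)+\ell-1\big)\Big).$$ Let $\mathfrak C_k=\{-\frac{p}{2(n+1)}:p=0,1,\dots,2k-2\}$ (empty for $k=0$). Proposition.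 Assume $\delta\notin\mathfrak C_k$ and $\delta'\notin\mathfrak C_{k'}$, and let $T:R^k_\delta\to R^{k'}_{\delta'}$ be an $\mathrm{sp}_{2n+2}$-invariant linear operator, i.e. $T\circ L_V=L_V\circ T$ for all $V\in\mathrm{sp}_{2n+2}$. Then: (1) For $0\le\ell\le k$, $R^{k,\ell}_\delta$ is an $\mathrm{sp}_{2n+2}$-submodule of $R^k_\delta$ and is the eigenspace $\ker(C^k_\delta-\varepsilon^{k,\ell}_\delta\,\mathrm{id})$ of the Casimir operator; likewise for $R^{k',\ell'}_{\delta'}\subset R^{k'}_{\delta'}$, $0\le\ell'\le k'$. (2) For each $\ell\in\{0,\dots,k\}$ the restriction $T_\ell$ of $T$ to $R^{k,\ell}_\delta$ either vanishes, or is an ($\mathrm{sp}_{2n+2}$-invariant) operator from $R^{k,\ell}_\delta$ into $R^{k',\ell'}_{\delta'}$ for exactly one $\ell'\in\{0,\dots,k'\}$; this $\ell'$ is the unique one in $\{0,\dots,k'\}$ with $\varepsilon^{k',\ell'}_{\delta'}=\varepsilon^{k,\ell}_\delta$. (3) The map $\ell\mapsto\ell'$, defined on the set of those $\ell$ for which $T_\ell\ne0$,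 is injective. -/

import Mathlib

open scoped ContDiff

noncomputable section

namespace ContactSymbols

/-! ### Smooth functions and vector fields on `ℝ^{2n+1}` -/

/-- Labels of the canonical coordinates `(p₁, …, pₙ, q¹, …, qⁿ, t)` of `ℝ^{2n+1}`. -/
abbrev Idx (n : ℕ) : Type := Fin n ⊕ Fin n ⊕ Unit

/-- The label of the coordinate `p_i`. -/
abbrev ip {n : ℕ} (i : Fin n) : Idx n := Sum.inl i
/-- The label of the coordinate `q^i`. -/
abbrev iq {n : ℕ} (i : Fin n) : Idx n := Sum.inr (Sum.inl i)
/-- The label of the coordinate `t`. -/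
abbrev it {n : ℕ} : Idx n := Sum.inr (Sum.inr ())

/-- The smooth functions, as a subalgebra of the algebra of all real functions. -/
def smoothSubalgebra (n : ℕ) : Subalgebra ℝ ((Idx n → ℝ) → ℝ) where
  carrier := {f | ContDiff ℝ ∞ f}
  mul_mem' {f g} hf hg := by
    simp only [Set.mem_ofPred_eq] at *
    exact hf.mul hg
  add_mem' {f g} hf hg := by
    simp only [Set.mem_ofPred_eq] at *
    exact hf.add hg
  algebraMap_mem' c := by
    simp only [Set.mem_ofPred_eq]
    exact contDiff_const

/-- The algebra `C^∞(ℝ^{2n+1})` of real smooth functions. -/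
def Smooth (n : ℕ) : Type := smoothSubalgebra n

instance (n : ℕ) : CommRing (Smooth n) := inferInstanceAs (CommRing (smoothSubalgebra n))

instance (n : ℕ) : Algebra ℝ (Smooth n) := inferInstanceAs (Algebra ℝ (smoothSubalgebra n))

instance (n : ℕ) : CoeFun (Smooth n) (fun _ => (Idx n → ℝ) → ℝ) := ⟨Subtype.val⟩

theorem Smooth.contDiff {n : ℕ} (f : Smooth n) : ContDiff ℝ ∞ (f : (Idx n → ℝ) → ℝ) := f.2

theorem Smooth.ext {n : ℕ} {f g : Smooth n} (h : ∀ x, f x = g x) : f = g :=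
  Subtype.ext (funext h)

/-- A smooth function, as an element of `C^∞(ℝ^{2n+1})`. -/
def Smooth.mk {n : ℕ} (f : (Idx n → ℝ) → ℝ) (hf : ContDiff ℝ ∞ f) : Smooth n := ⟨f, hf⟩

/-- The coordinate function with label `i`. -/
def coord {n : ℕ} (i : Idx n) : Smooth n := Smooth.mk (fun x => x i) (contDiff_apply ℝ ℝ i)

theorem Smooth.differentiableAt {n : ℕ} (f : Smooth n) (x : Idx n → ℝ) :
    DifferentiableAt ℝ (f : (Idx n → ℝ) → ℝ) x :=
  (f.contDiff.differentiable (by simp)).differentiableAt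

/-- Vector fields of `ℝ^{2n+1}`, as derivations of the algebra of smooth functions, with the
commutator as Lie bracket. -/
abbrev Vect (n : ℕ) : Type := Derivation ℝ (Smooth n) (Smooth n)

/-- The coordinate vector field `∂_i`. -/
def pd {n : ℕ} (i : Idx n) : Vect n :=
  Derivation.mk'
    { toFun := fun f => Smooth.mk (fun x => fderiv ℝ f x (Pi.single i 1))
        ((f.contDiff.fderiv_right (m := ∞) (by simp)).clm_apply contDiff_const)
      map_add' := fun f g => Smooth.ext fun x =>
        congrArg (fun l => l (Pi.single i 1))
          (fderiv_add (f.differentiableAt x) (g.differentiableAt x))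
      map_smul' := fun c f => Smooth.ext fun x =>
        congrArg (fun l => l (Pi.single i 1)) (fderiv_const_smul (f.differentiableAt x) c) }
    (fun f g => Smooth.ext fun x =>
      congrArg (fun l => l (Pi.single i 1))
          (fderiv_mul (f.differentiableAt x) (g.differentiableAt x)))

theorem vect_sum_apply {n : ℕ} {κ : Type*} (s : Finset κ) (D : κ → Vect n) (f : Smooth n) :
    (∑ k ∈ s, D k) f = ∑ k ∈ s, D k f := by
  induction s using Finset.cons_induction with
  | empty => simp
  | cons a s h ih => rw [Finset.sum_cons, Finset.sum_cons, Derivation.add_apply, ih]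

/-- The spatial Euler field `E_s = ∑_k (p_k ∂_{p_k} + q^k ∂_{q^k})`. -/
def eulerS (n : ℕ) : Vect n :=
  ∑ k : Fin n, (coord (ip k) • pd (ip k) + coord (iq k) • pd (iq k))

/-- The contact Hamiltonian vector field of the function `h`:
`X_h = ∑_k (∂_{p_k}h ∂_{q^k} - ∂_{q^k}h ∂_{p_k}) + E_s(h) ∂_t - ∂_t h E_s - 2 h ∂_t`. -/
def contactField {n : ℕ} : Smooth n →ₗ[ℝ] Vect n where
  toFun h := (∑ k : Fin n, (pd (ip k) h • pd (iq k) - pd (iq k) h • pd (ip k)))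
    + eulerS n h • pd it - pd it h • eulerS n - (2 : ℝ) • (h • pd it)
  map_add' h g := by
    ext1 f
    simp only [Derivation.add_apply, Derivation.sub_apply, Derivation.smul_apply, vect_sum_apply,
      map_add, add_smul, smul_add, Finset.sum_add_distrib, Finset.sum_sub_distrib]
    abel
  map_smul' c h := by
    ext1 f
    simp only [Derivation.add_apply, Derivation.sub_apply, Derivation.smul_apply, vect_sum_apply,
      Derivation.map_smul, smul_assoc, RingHom.id_apply, smul_sub, smul_add,
      Finset.smul_sum, smul_comm c (2 : ℝ)]

/-! ### The Lie algebra `sp_{2n+2}` of infinitesimal projective contact transformations -/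

/-- The coordinate functions of `ℝ^{2n+1}`, together with the constant function `1`. -/
def xhat {n : ℕ} : Option (Idx n) → Smooth n
  | none => 1
  | some i => coord i

/-- The polynomial functions of degree at most two on `ℝ^{2n+1}`, i.e. the span of the monomials
`1`, `x_i`, `x_i x_j`. -/
def polLeTwo (n : ℕ) : Submodule ℝ (Smooth n) :=
  Submodule.span ℝ (Set.range fun a : Option (Idx n) × Option (Idx n) => xhat a.1 * xhat a.2)

theorem pd_coord {n : ℕ} (i j : Idx n) :
    pd i (coord j) = if j = i then 1 else 0 := by
  refine Smooth.ext fun x => ?_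
  have : (fderiv ℝ (fun y : Idx n → ℝ => y j) x) (Pi.single i 1)
      = (Pi.single i 1 : Idx n → ℝ) j := by
    rw [(hasFDerivAt_apply j x).fderiv]; rfl
  refine this.trans ?_
  rw [Pi.single_apply]
  split_ifs <;> rfl

theorem pd_comm {n : ℕ} (i j : Idx n) (f : Smooth n) : pd i (pd j f) = pd j (pd i f) := by
  refine Smooth.ext fun x => ?_
  have hf := f.contDiff
  have hd : DifferentiableAt ℝ (fderiv ℝ f) x :=
    ((hf.fderiv_right (m := ∞) (by simp)).differentiable (by simp)).differentiableAt
  have key : ∀ a b : Idx n, (pd a (pd b f)) x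
      = fderiv ℝ (fderiv ℝ f) x (Pi.single a 1) (Pi.single b 1) := by
    intro a b
    change fderiv ℝ (fun y => fderiv ℝ f y (Pi.single b 1)) x
      (Pi.single a 1) = _
    rw [fderiv_clm_apply hd (differentiableAt_const _)]
    simp
  rw [key, key]
  exact (hf.contDiffAt.isSymmSndFDerivAt (by simpa using (WithTop.coe_le_coe.2 (le_top : (2 : ℕ∞) ≤ ⊤)))) _ _


/-- The derivations `∑ f_i ∂_i`. -/
def IsComb {n : ℕ} (D : Vect n) : Prop := ∀ f, D f = ∑ i, D (coord i) * pd i f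

theorem IsComb.pd {n : ℕ} (i : Idx n) : IsComb (pd i) := fun f => by
  simp [pd_coord]

theorem IsComb.add {n : ℕ} {D E : Vect n} (hD : IsComb D) (hE : IsComb E) :
    IsComb (D + E) := fun f => by
  simp only [Derivation.add_apply, add_mul, Finset.sum_add_distrib]
  rw [← hD f, ← hE f]

theorem IsComb.smul {n : ℕ} {D : Vect n} (g : Smooth n) (hD : IsComb D) :
    IsComb (g • D) := fun f => by
  simp only [Derivation.smul_apply, smul_eq_mul, mul_assoc, ← Finset.mul_sum]
  rw [← hD f]

theorem IsComb.neg {n : ℕ} {D : Vect n} (hD : IsComb D) : IsComb (-D) := fun f => by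
  rw [Derivation.neg_apply, hD f, ← Finset.sum_neg_distrib]
  exact Finset.sum_congr rfl fun i _ => by rw [Derivation.neg_apply]; ring

theorem IsComb.sum {n : ℕ} {κ : Type*} (s : Finset κ) (D : κ → Vect n)
    (hD : ∀ k, IsComb (D k)) : IsComb (∑ k ∈ s, D k) := by
  induction s using Finset.cons_induction with
  | empty => intro f; simp
  | cons a s h ih => rw [Finset.sum_cons]; exact (hD a).add ih

theorem IsComb.lie {n : ℕ} {D E : Vect n} (hD : IsComb D) (hE : IsComb E) :
    IsComb ⁅D, E⁆ := fun f => by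
  have h1 : ∀ {D E : Vect n}, IsComb D → IsComb E → D (E f)
      = ∑ i, D (E (coord i)) * ContactSymbols.pd i f
        + ∑ i, ∑ j, E (coord i) * D (coord j) * ContactSymbols.pd j (ContactSymbols.pd i f) := by
    intro D E hD hE
    rw [hE f, map_sum, ← Finset.sum_add_distrib]
    refine Finset.sum_congr rfl fun i _ => ?_
    rw [Derivation.leibniz, hD (ContactSymbols.pd i f)]
    simp only [smul_eq_mul, Finset.mul_sum, mul_assoc]
    rw [add_comm, mul_comm]
  rw [Derivation.commutator_apply, h1 hD hE, h1 hE hD]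
  have h2 : ∑ i, ∑ j, E (coord i) * D (coord j) * ContactSymbols.pd j (ContactSymbols.pd i f)
      = ∑ i, ∑ j, D (coord i) * E (coord j) * ContactSymbols.pd j (ContactSymbols.pd i f) := by
    rw [Finset.sum_comm]
    refine Finset.sum_congr rfl fun i _ => Finset.sum_congr rfl fun j _ => ?_
    rw [pd_comm, mul_comm (E _)]
  rw [h2]
  simp only [Derivation.commutator_apply, sub_mul, Finset.sum_sub_distrib]
  ring

theorem IsComb.ext {n : ℕ} {D E : Vect n} (hD : IsComb D) (hE : IsComb E)
    (h : ∀ i, D (coord i) = E (coord i)) : D = E := by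
  ext1 f
  rw [hD f, hE f]
  simp only [h]

theorem isComb_contactField {n : ℕ} (h : Smooth n) : IsComb (contactField h) := by
  have hs : IsComb (eulerS n) :=
    IsComb.sum _ _ fun k => ((IsComb.pd _).smul _).add ((IsComb.pd _).smul _)
  have h1 : IsComb (∑ k : Fin n, (pd (ip k) h • pd (iq k) + -(pd (iq k) h • pd (ip k)))) :=
    IsComb.sum _ _ fun k => ((IsComb.pd _).smul _).add ((IsComb.pd _).smul _).neg
  have h2 := ((h1.add ((IsComb.pd it).smul (eulerS n h))).add (hs.smul (pd it h)).neg).add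
    (((IsComb.pd it).smul h).smul (algebraMap ℝ (Smooth n) 2)).neg
  convert h2 using 1
  ext1 f
  simp only [contactField, LinearMap.coe_mk, AddHom.coe_mk, Derivation.add_apply,
    Derivation.neg_apply, Derivation.smul_apply, vect_sum_apply,
    sub_eq_add_neg, algebraMap_smul]

theorem contactField_mul {n : ℕ} (f g u : Smooth n) :
    contactField (f * g) u = f * (contactField g u + g * pd it u)
      + g * (contactField f u + f * pd it u) := by
  simp only [contactField, LinearMap.coe_mk, AddHom.coe_mk, Derivation.add_apply,
    Derivation.sub_apply, Derivation.smul_apply, vect_sum_apply, Derivation.leibniz,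
    smul_eq_mul, Algebra.smul_def]
  have : ∑ k : Fin n, ((f * pd (ip k) g + g * pd (ip k) f) * pd (iq k) u
        - (f * pd (iq k) g + g * pd (iq k) f) * pd (ip k) u)
      = f * ∑ k : Fin n, (pd (ip k) g * pd (iq k) u - pd (iq k) g * pd (ip k) u)
        + g * ∑ k : Fin n, (pd (ip k) f * pd (iq k) u - pd (iq k) f * pd (ip k) u) := by
    rw [Finset.mul_sum, Finset.mul_sum, ← Finset.sum_add_distrib]
    exact Finset.sum_congr rfl fun k _ => by ring
  rw [this]
  simp only [map_ofNat]
  ring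

theorem contactField_apply {n : ℕ} (h u : Smooth n) :
    contactField h u = (∑ k : Fin n, (pd (ip k) h * pd (iq k) u - pd (iq k) h * pd (ip k) u))
      + eulerS n h * pd it u - pd it h * eulerS n u - 2 * (h * pd it u) := by
  simp only [contactField, LinearMap.coe_mk, AddHom.coe_mk, Derivation.add_apply,
    Derivation.sub_apply, Derivation.smul_apply, vect_sum_apply, smul_eq_mul, Algebra.smul_def,
    map_ofNat]

theorem eulerS_ip {n : ℕ} (i : Fin n) : eulerS n (coord (ip i)) = coord (ip i) := by
  simp [eulerS, vect_sum_apply, pd_coord]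

theorem eulerS_iq {n : ℕ} (i : Fin n) : eulerS n (coord (iq i)) = coord (iq i) := by
  simp [eulerS, vect_sum_apply, pd_coord]

theorem eulerS_it {n : ℕ} (i : Unit) : eulerS n (coord (Sum.inr (Sum.inr i))) = 0 := by
  simp [eulerS, vect_sum_apply, pd_coord]

theorem exists_omega (n : ℕ) : ∃ om : Option (Idx n) → Option (Idx n) → ℝ,
    (∀ a b, om a b = -om b a) ∧ ∀ a c, contactField (xhat a) (xhat c) + xhat a * pd it (xhat c)
      = algebraMap ℝ (Smooth n) (om a c) - algebraMap ℝ (Smooth n) (om a none) * xhat c := by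
  refine ⟨fun a b => match a, b with
    | some (.inl i), some (.inr (.inl j)) => if i = j then 1 else 0
    | some (.inr (.inl i)), some (.inl j) => if i = j then -1 else 0
    | some (.inr (.inr _)), none => 1
    | none, some (.inr (.inr _)) => -1
    | _, _ => 0, ?_, ?_⟩
  · rintro (_ | i | i | i) (_ | j | j | j) <;> simp [eq_comm] <;> split_ifs <;> simp
  · rintro (_ | i | i | i) (_ | j | j | j) <;>
      simp only [xhat, contactField_apply, eulerS_ip, eulerS_iq, eulerS_it, pd_coord]
    all_goals simp
    all_goals try split_ifs
    all_goals try simp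
    all_goals try ring

theorem lie_contactField_mem {n : ℕ} {f g : Smooth n} (hf : f ∈ polLeTwo n)
    (hg : g ∈ polLeTwo n) :
    ⁅contactField f, contactField g⁆ ∈ (polLeTwo n).map (contactField (n := n)) := by
  obtain ⟨om, hom, hY⟩ := exists_omega n
  have hX : ∀ a b c : Option (Idx n), contactField (xhat a * xhat b) (xhat c)
      = xhat a * (algebraMap ℝ (Smooth n) (om b c) - algebraMap ℝ (Smooth n) (om b none) * xhat c)
      + xhat b * (algebraMap ℝ (Smooth n) (om a c) - algebraMap ℝ (Smooth n) (om a none) * xhat c) :=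
    fun a b c => by rw [contactField_mul, hY, hY]
  have hmem : ∀ (r : ℝ) (a b : Option (Idx n)), r • (xhat a * xhat b) ∈ polLeTwo n :=
    fun r a b => Submodule.smul_mem _ _ (Submodule.subset_span ⟨(a, b), rfl⟩)
  refine Submodule.span_induction₂ (p := fun f g _ _ => ⁅contactField f, contactField g⁆ ∈
    (polLeTwo n).map (contactField (n := n))) ?_ ?_ ?_ ?_ ?_ ?_ ?_ hf hg
  · rintro _ _ ⟨⟨a, b⟩, rfl⟩ ⟨⟨c, d⟩, rfl⟩
    refine ⟨om a c • (xhat b * xhat d) + om a d • (xhat b * xhat c) + om b c • (xhat a * xhat d)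
      + om b d • (xhat a * xhat c), add_mem (add_mem (add_mem (hmem _ _ _) (hmem _ _ _))
        (hmem _ _ _)) (hmem _ _ _), ?_⟩
    refine IsComb.ext (isComb_contactField _)
      ((isComb_contactField _).lie (isComb_contactField _)) fun i => ?_
    change _ = ⁅contactField (xhat a * xhat b), contactField (xhat c * xhat d)⁆ (coord i)
    have hi : coord i = xhat (some i) := rfl
    rw [Derivation.commutator_apply, hi]
    simp only [map_add, map_smul, Derivation.add_apply, Derivation.smul_apply, hX, map_sub,
      Derivation.leibniz, smul_eq_mul, Derivation.map_algebraMap]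
    simp only [Algebra.smul_def]
    rw [hom c a, hom c b, hom d a, hom d b]
    simp only [map_neg]
    ring
  · intro y _; simp
  · intro y _; simp
  · intro x y z _ _ _ h1 h2; rw [map_add, add_lie]; exact add_mem h1 h2
  · intro x y z _ _ _ h1 h2; rw [map_add, lie_add]; exact add_mem h1 h2
  · intro r x y _ _ h; rw [map_smul, smul_lie]; exact Submodule.smul_mem _ _ h
  · intro r x y _ _ h; rw [map_smul, lie_smul]; exact Submodule.smul_mem _ _ h

/-- The Lie algebra `sp_{2n+2}` of infinitesimal projective contact transformations: the contact
Hamiltonian vector fields of the polynomials of degree at most two. -/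
def sp (n : ℕ) : LieSubalgebra ℝ (Vect n) where
  toSubmodule := (polLeTwo n).map (contactField (n := n))
  lie_mem' := by
    rintro _ _ ⟨f, hf, rfl⟩ ⟨g, hg, rfl⟩
    exact lie_contactField_mem hf hg

instance (n : ℕ) : Module.Finite ℝ (sp n) := by
  have : Module.Finite ℝ (polLeTwo n) := Module.Finite.span_of_finite ℝ (Set.finite_range _)
  exact inferInstanceAs (Module.Finite ℝ ((polLeTwo n).map (contactField (n := n))))

/-! ### Symbol modules -/

/-- Polynomials in the fibre variables `ξ_i` with coefficients in `C^∞(ℝ^{2n+1})`. -/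
abbrev Pol (n : ℕ) : Type := MvPolynomial (Idx n) (Smooth n)

/-- The fibre variable `ξ_i`. -/
abbrev xi {n : ℕ} (i : Idx n) : Pol n := MvPolynomial.X i

/-- The function `f`, as a symbol of degree zero. -/
abbrev cst {n : ℕ} (f : Smooth n) : Pol n := MvPolynomial.C f

/-- The derivative `∂_{ξ_i}` along the fibre. -/
abbrev dxi {n : ℕ} (i : Idx n) (P : Pol n) : Pol n := MvPolynomial.pderiv i P

/-- The space of symmetric contravariant tensor fields of degree `k` on `ℝ^{2n+1}`, as polynomials
homogeneous of degree `k` in the fibre variables. Densities are trivialized by the standard volume,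
so that this is the underlying space of the symbol module `S^k_w` for every density weight `w`, and
of `R^k_δ = S^k_{δ + k/(n+1)}` for every `δ`. -/
abbrev Symb (n k : ℕ) : Submodule ℝ (Pol n) :=
  (MvPolynomial.homogeneousSubmodule (Idx n) (Smooth n) k).restrictScalars ℝ

theorem mem_symb {n k : ℕ} {P : Pol n} : P ∈ Symb n k ↔ P.IsHomogeneous k := Iff.rfl

/-- The polynomial obtained by applying the vector field `D` to each coefficient of `P`. -/
def onCoeffFun {n : ℕ} (D : Vect n) (P : Pol n) : Pol n :=
  ∑ m ∈ P.support, MvPolynomial.monomial m (D (P.coeff m))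

theorem coeff_onCoeffFun {n : ℕ} (D : Vect n) (P : Pol n) (m : Idx n →₀ ℕ) :
    (onCoeffFun D P).coeff m = D (P.coeff m) := by
  classical
  simp only [onCoeffFun, MvPolynomial.coeff_sum, MvPolynomial.coeff_monomial,
    Finset.sum_ite_eq', MvPolynomial.mem_support_iff]
  split_ifs with h
  · rfl
  · rw [not_not.1 h, map_zero]

/-- The action of vector fields on the coefficients of polynomials in the fibre variables. -/
def onCoeff {n : ℕ} : Vect n →ₗ[ℝ] Module.End ℝ (Pol n) :=
  LinearMap.mk₂ ℝ onCoeffFun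
    (fun D E P => by
      ext1 m; simp only [coeff_onCoeffFun, MvPolynomial.coeff_add, Derivation.add_apply])
    (fun c D P => by
      ext1 m; simp only [coeff_onCoeffFun, MvPolynomial.coeff_smul, Derivation.smul_apply])
    (fun D P Q => by
      ext1 m; simp only [coeff_onCoeffFun, MvPolynomial.coeff_add, map_add])
    (fun c D P => by
      ext1 m; simp only [coeff_onCoeffFun, MvPolynomial.coeff_smul, Derivation.map_smul])

theorem onCoeff_mem {n k : ℕ} (D : Vect n) {P : Pol n} (hP : P ∈ Symb n k) :
    onCoeff D P ∈ Symb n k := by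
  intro m hm
  refine hP fun h0 => hm ?_
  change (onCoeffFun D P).coeff m = 0
  rw [coeff_onCoeffFun, h0, map_zero]

/-- The action of the vector field `D` on symbols of density weight `w`:
`L_D P = D(P) - ∑_{i,j} ∂_j D^i ξ_i ∂_{ξ_j} P + w (∑_i ∂_i D^i) P`. -/
def lieTotal (n : ℕ) (w : ℝ) : Vect n →ₗ[ℝ] Module.End ℝ (Pol n) :=
  LinearMap.mk₂ ℝ
    (fun D P => onCoeff D P
      - (∑ i, ∑ j, cst (pd j (D (coord i))) * xi i * dxi j P)
      + w • (cst (∑ i, pd i (D (coord i))) * P))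
    (fun D E P => by
      simp only [map_add, LinearMap.add_apply, Derivation.add_apply, add_mul,
        Finset.sum_add_distrib, smul_add]
      abel)
    (fun c D P => by
      have hc : ∀ f : Smooth n, cst (c • f) = c • cst f := fun f => by
        ext1 m
        simp only [MvPolynomial.coeff_smul, MvPolynomial.coeff_C, smul_ite, smul_zero]
      simp only [map_smul, LinearMap.smul_apply, Derivation.smul_apply, Derivation.map_smul, hc,
        ← Finset.smul_sum, smul_mul_assoc, smul_add, smul_sub, smul_comm w c])
    (fun D P Q => by
      simp only [map_add, mul_add, Finset.sum_add_distrib, smul_add]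
      abel)
    (fun c D P => by
      simp only [map_smul, Derivation.map_smul_of_tower, ← Finset.smul_sum, mul_smul_comm,
        smul_add, smul_sub, smul_comm w c])

theorem cst_mul_mem {n k : ℕ} (f : Smooth n) {P : Pol n} (hP : P ∈ Symb n k) :
    cst f * P ∈ Symb n k := by
  simpa using (MvPolynomial.isHomogeneous_C _ f).mul (mem_symb.1 hP)

theorem xi_mul_mem {n k : ℕ} (i : Idx n) {P : Pol n} (hP : P ∈ Symb n k) :
    xi i * P ∈ Symb n (k + 1) := by
  simpa [add_comm] using (MvPolynomial.isHomogeneous_X (Smooth n) i).mul (mem_symb.1 hP)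

theorem dxi_mem {n k : ℕ} (i : Idx n) {P : Pol n} (hP : P ∈ Symb n k) :
    dxi i P ∈ Symb n (k - 1) := (mem_symb.1 hP).pderiv

theorem xi_mul_dxi_mem {n k : ℕ} (i j : Idx n) {P : Pol n} (hP : P ∈ Symb n k) :
    xi i * dxi j P ∈ Symb n k := by
  rcases k with _ | k
  · have : dxi j P = 0 := by
      have h := mem_symb.1 hP
      rw [← MvPolynomial.totalDegree_zero_iff_isHomogeneous,
        MvPolynomial.totalDegree_eq_zero_iff_eq_C] at h
      rw [h, dxi, MvPolynomial.pderiv_C]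
    rw [this, mul_zero]
    exact zero_mem _
  · exact xi_mul_mem i (dxi_mem j hP)

theorem lieTotal_mem {n k : ℕ} (w : ℝ) (D : Vect n) {P : Pol n} (hP : P ∈ Symb n k) :
    lieTotal n w D P ∈ Symb n k := by
  refine add_mem (sub_mem (onCoeff_mem D hP) (sum_mem fun i _ => sum_mem fun j _ => ?_))
    (Submodule.smul_mem _ _ (cst_mul_mem _ hP))
  rw [mul_assoc]
  exact cst_mul_mem _ (xi_mul_dxi_mem i j hP)

/-- The Lie derivative of symbols of degree `k` and density weight `w`, i.e. the action of vector
fields on the module `S^k_w`. -/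
def lieSymb (n k : ℕ) (w : ℝ) : Vect n →ₗ[ℝ] Module.End ℝ (Symb n k) where
  toFun D := (lieTotal n w D).restrict fun _ hP => lieTotal_mem w D hP
  map_add' D E := by
    ext1 P
    exact Subtype.ext (by simp [LinearMap.restrict_apply])
  map_smul' c D := by
    ext1 P
    exact Subtype.ext (by simp [LinearMap.restrict_apply])

/-- The density weight `δ + k/(n+1)` of the module `R^k_δ`. -/
def weight (n k : ℕ) (δ : ℝ) : ℝ := δ + k / (n + 1)

/-- The action of vector fields on `R^k_δ = S^k_{δ + k/(n+1)}`. -/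
def lieR (n k : ℕ) (δ : ℝ) : Vect n →ₗ[ℝ] Module.End ℝ (Symb n k) := lieSymb n k (weight n k δ)

/-! ### The Casimir operator -/

/-- The Casimir operator of the representation `ρ`, with respect to the Killing form: if `(b_i)` is
a basis and `(b^i)` the basis that is dual for the Killing form, it is `∑_i ρ(b_i) ρ(b^i)`. Here
`b^i = ∑_j (G⁻¹)_{ij} b_j` with the Gram matrix `G` of the Killing form. -/
def casimir {𝔤 M : Type*} [LieRing 𝔤] [LieAlgebra ℝ 𝔤] [Module.Finite ℝ 𝔤] [AddCommGroup M]
    [Module ℝ M] (ρ : 𝔤 →ₗ[ℝ] Module.End ℝ M) : Module.End ℝ M :=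
  let b := Module.finBasis ℝ 𝔤
  let G := Matrix.of fun i j => killingForm ℝ 𝔤 (b i) (b j)
  ∑ i, ρ (b i) * ρ (∑ j, G⁻¹ i j • b j)

/-- The Casimir operator `C^k_δ` of the action of `sp_{2n+2}` on `R^k_δ`. -/
def casimirR (n k : ℕ) (δ : ℝ) : Module.End ℝ (Symb n k) :=
  casimir ((lieR n k δ).comp (sp n).toSubmodule.subtype : sp n →ₗ[ℝ] Module.End ℝ (Symb n k))

/-! ### The operators `i_α` and `X`, and the submodules `R^{k,ℓ}_δ` -/

/-- The contraction of symbols with the contact form `α = ½ (∑_j (p_j dq^j - q^j dp_j) - dt)`. -/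
def iAlpha (n k : ℕ) : Symb n k →ₗ[ℝ] Symb n (k - 1) where
  toFun P := ⟨(1 / 2 : ℝ) • ((∑ j : Fin n, (cst (coord (ip j)) * dxi (iq j) P
      - cst (coord (iq j)) * dxi (ip j) P)) - dxi it P),
    Submodule.smul_mem _ _ (sub_mem (sum_mem fun j _ => sub_mem (cst_mul_mem _ (dxi_mem _ P.2))
      (cst_mul_mem _ (dxi_mem _ P.2))) (dxi_mem _ P.2))⟩
  map_add' P Q := Subtype.ext (by
    simp only [Submodule.coe_add, map_add, mul_add, Finset.sum_add_distrib, ← smul_add,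
      Finset.sum_sub_distrib]
    congr 1
    abel)
  map_smul' c P := Subtype.ext (by
    simp only [Submodule.coe_smul, Derivation.map_smul_of_tower, mul_smul_comm, ← Finset.smul_sum,
      ← smul_sub, RingHom.id_apply, smul_comm c (1 / 2 : ℝ)])

/-- The generalized contact Hamiltonian `X : S^k_w → S^{k+1}_{w + 1/(n+1)}`:
`X(S) = ∑_j (ξ_{q^j} ∂_{p_j} - ξ_{p_j} ∂_{q^j}) S + ξ_t E_s S - ⟨E_s, ξ_s⟩ ∂_t S + a ξ_t S`, where
`a = 2(n+1)w - k`. -/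
def genHam (n k : ℕ) (w : ℝ) : Symb n k →ₗ[ℝ] Symb n (k + 1) where
  toFun P := ⟨(∑ j : Fin n, (xi (iq j) * onCoeff (pd (ip j)) P
        - xi (ip j) * onCoeff (pd (iq j)) P))
      + xi it * onCoeff (eulerS n) P
      - (∑ j : Fin n, (cst (coord (ip j)) * (xi (ip j) * onCoeff (pd it) P)
        + cst (coord (iq j)) * (xi (iq j) * onCoeff (pd it) P)))
      + (2 * (n + 1) * w - k) • (xi it * (P : Pol n)),
    add_mem (sub_mem (add_mem
      (sum_mem fun j _ => sub_mem (xi_mul_mem _ (onCoeff_mem _ P.2))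
        (xi_mul_mem _ (onCoeff_mem _ P.2)))
      (xi_mul_mem _ (onCoeff_mem _ P.2)))
      (sum_mem fun j _ => add_mem (cst_mul_mem _ (xi_mul_mem _ (onCoeff_mem _ P.2)))
        (cst_mul_mem _ (xi_mul_mem _ (onCoeff_mem _ P.2)))))
      (Submodule.smul_mem _ _ (xi_mul_mem _ P.2))⟩
  map_add' P Q := Subtype.ext (by
    simp only [Submodule.coe_add, map_add, mul_add, Finset.sum_add_distrib, smul_add,
      Finset.sum_sub_distrib]
    abel)
  map_smul' c P := Subtype.ext (by
    simp only [Submodule.coe_smul, map_smul, mul_smul_comm, ← Finset.smul_sum,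
      ← smul_sub, ← smul_add, RingHom.id_apply, smul_comm _ c])

/-- The power `X^ℓ : R^j_δ → R^{j+ℓ}_δ`. -/
def genHamPow (n j : ℕ) (δ : ℝ) : (ℓ : ℕ) → Symb n j →ₗ[ℝ] Symb n (j + ℓ)
  | 0 => LinearMap.id
  | ℓ + 1 => genHam n (j + ℓ) (weight n (j + ℓ) δ) ∘ₗ genHamPow n j δ ℓ

/-- The subspace `R^{k,ℓ}_δ = X^ℓ (R^{k-ℓ}_δ ∩ ker i_α)` of `R^k_δ`, for `ℓ ≤ k`. (The image of
`X^ℓ` consists of symbols of degree `(k - ℓ) + ℓ`.) -/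
def subR (n k : ℕ) (δ : ℝ) (ℓ : ℕ) : Submodule ℝ (Symb n k) :=
  ((LinearMap.ker (iAlpha n (k - ℓ))).map
    ((Symb n (k - ℓ + ℓ)).subtype ∘ₗ genHamPow n (k - ℓ) δ ℓ)).comap (Symb n k).subtype

/-- The set `𝔠_k = {-p/(2(n+1)) : p = 0, 1, …, 2k-2}`, which is empty for `k = 0`. -/
def critical (n k : ℕ) : Set ℝ := {δ | ∃ p : ℕ, p + 2 ≤ 2 * k ∧ δ = -(p : ℝ) / (2 * (n + 1))}

/-- The number `ε^{k,ℓ}_δ = (c(k,δ) + r(ℓ,k-ℓ)) / (n+2)`, where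
`c(k,δ) = (n+1)²δ² - (n+1)²δ + k(n+1)δ + (k²-k)/2` and `r(ℓ,j) = -ℓ/2 (2(n+1)δ + 2j + ℓ - 1)`. -/
def eigenval (n k : ℕ) (δ : ℝ) (ℓ : ℕ) : ℝ :=
  1 / (n + 2) * (((n + 1) ^ 2 * δ ^ 2 - (n + 1) ^ 2 * δ + k * (n + 1) * δ + ((k : ℝ) ^ 2 - k) / 2)
    + -(ℓ : ℝ) / 2 * (2 * (n + 1) * δ + 2 * ((k : ℝ) - ℓ) + ℓ - 1))

end ContactSymbols

end

open ContactSymbols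

/-! The Casimir operator separates the summands. An invariant `T` intertwines the Casimir operators
of source and target (`casimir_intertwine`), so it preserves eigenvalues; a nonzero image forces the
eigenvalue to occur in the target. Everything follows once the spaces `subR` are known to be the
Casimir eigenspaces, with pairwise distinct eigenvalues.

For this, the Casimir operator of `R^k_δ` is shown to be a scalar plus a multiple of `X ∘ i_α`
(`coe_casimirR`). The operators `i_α` and `X` satisfy an sl₂-type relation: up to a factor, their
commutator is a scalar in each degree (`opContr_opHam`). Hence `X^ℓ` sends `ker i_α` to eigenvectors
of `X ∘ i_α` (`component_le_eigenspace`). Noncriticality of `δ` enters twice: the scalars in the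
relation do not vanish, so these vectors span `R^k_δ` (`symb_le_iSup_component`), and the
eigenvalues are distinct (`eigenval_injective`).

The Casimir operator is computed in `2n+2` homogeneous coordinates indexed by `Option (Idx n)`, with
`x_none = 1`. The derivative `∂_none` is defined by an Euler relation of degree `-lam`, where `lam =
2(n+1)w - k` carries the density weight, and `ξ_none` by `∑ x_a ξ_a = 0`. The Lie derivatives along
the fields of the `x_a x_b` then have the uniform shape `quadLie`, the Killing form is expressed by
the symplectic matrix `omega`, and the Casimir operator becomes a full contraction with `omega`
(`casimir_sp`, `sum_quadLie_mul_quadLie`). -/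

namespace ContactSymbols

/-! ### Symplectic index calculus and the quadratic Casimir element in an abstract ring. -/

section HomogeneousWeyl

variable {R O : Type*} [Ring R] [Algebra ℝ R] [Fintype O]

/-- Raising of an index with the matrix `om`. -/
def raise (om : O → O → ℝ) (F : O → R) (a : O) : R := ∑ c, om a c • F c

/-- An antisymmetric orthogonal matrix, i.e. the matrix of a symplectic form in a symplectic
basis. -/
structure IsSymplectic [DecidableEq O] (om : O → O → ℝ) : Prop where
  antisymm : ∀ a b, om a b = -om b a
  orthogonal : ∀ c e, ∑ a, om a c * om a e = if c = e then 1 else 0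

theorem IsSymplectic.orthogonal' [DecidableEq O] {om : O → O → ℝ} (h : IsSymplectic om) (c e : O) :
    ∑ a, om c a * om e a = if c = e then 1 else 0 := by
  rw [← h.orthogonal]
  exact Finset.sum_congr rfl fun a _ => by rw [h.antisymm c a, h.antisymm e a]; ring

variable {om : O → O → ℝ}

/-- The see-saw rule: moving the raising to the other factor transposes `om`, hence the sign. The
order of the noncommuting factors is unchanged. -/
theorem sum_mul_raise_mul (h : ∀ a b, om a b = -om b a) (F G : O → R) (B : R) :
    ∑ a, F a * B * raise om G a = -∑ a, raise om F a * B * G a := by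
  simp only [raise, Finset.mul_sum, Finset.sum_mul]
  rw [Finset.sum_comm, ← Finset.sum_neg_distrib]
  refine Finset.sum_congr rfl fun a _ => ?_
  rw [← Finset.sum_neg_distrib]
  refine Finset.sum_congr rfl fun c _ => ?_
  rw [h a c]
  simp

theorem sum_mul_raise (h : ∀ a b, om a b = -om b a) (F G : O → R) :
    ∑ a, F a * raise om G a = -∑ a, raise om F a * G a := by
  simpa using sum_mul_raise_mul h F G 1

theorem sum_mul_raise_self (h : ∀ a b, om a b = -om b a) (F : O → R)
    (hF : ∀ a b, F a * F b = F b * F a) : ∑ a, F a * raise om F a = 0 := by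
  have h1 := sum_mul_raise h F F
  have h2 : ∑ a, raise om F a * F a = ∑ a, F a * raise om F a := by
    simp only [raise, Finset.mul_sum, Finset.sum_mul]
    refine Finset.sum_congr rfl fun a _ => Finset.sum_congr rfl fun c _ => ?_
    rw [smul_mul_assoc, mul_smul_comm, hF]
  rw [h2] at h1
  have h3 : (2 : ℝ) • ∑ a, F a * raise om F a = 0 := by
    rw [two_smul]; nth_rw 1 [h1]; simp
  exact (smul_eq_zero.1 h3).resolve_left two_ne_zero

variable [DecidableEq O]

/-- An antisymmetric orthogonal matrix squares to `-1`. -/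
theorem raise_raise (h : IsSymplectic om) (F : O → R) (a : O) :
    raise om (raise om F) a = -F a := by
  simp only [raise, Finset.smul_sum, smul_smul]
  rw [Finset.sum_comm]
  simp only [← Finset.sum_smul]
  have : ∀ e, ∑ c, om a c * om c e = if a = e then (-1 : ℝ) else 0 := fun e => by
    rw [← neg_inj, ← Finset.sum_neg_distrib]
    have := h.orthogonal a e
    simp only [h.antisymm _ a, neg_mul] at this
    rw [this]; split_ifs <;> simp
  simp [this, ite_smul]

theorem sum_raise_mul_raise (h : IsSymplectic om) (F G : O → R) :
    ∑ a, raise om F a * raise om G a = ∑ a, F a * G a := by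
  rw [sum_mul_raise h.antisymm]
  simp [raise_raise h]

/-- The commutation relations of the operators `x_a`, `∂_a`, `ξ_a`, `∂_{ξ_a}` on symbols,
written in homogeneous coordinates. The index `o` is the one of the homogenizing coordinate, and
`∂_o` acts by the Euler relation `∑ x_a ∂_a = -lam`. -/
structure HomogWeyl (o : O) (lam : ℝ) (x nab xi eta : O → R) : Prop where
  x_o : x o = 1
  eta_o : eta o = 0
  xx : ∀ a b, x a * x b = x b * x a
  ee : ∀ a b, eta a * eta b = eta b * eta a
  kk : ∀ a b, xi a * xi b = xi b * xi a
  ex : ∀ a b, eta a * x b = x b * eta a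
  kx : ∀ a b, xi a * x b = x b * xi a
  en : ∀ a b, eta a * nab b = nab b * eta a
  nx : ∀ c a, nab c * x a = x a * nab c + (if c = a then 1 else 0) - (if c = o then x a else 0)
  ek : ∀ a c, eta a * xi c = xi c * eta a + (if c = a then 1 else 0) - (if c = o then x a else 0)
  nk : ∀ c d, nab c * xi d = xi d * nab c - (if d = o then xi c else 0)
  nn : ∀ c d, nab c * nab d = nab d * nab c + (if c = o then nab d else 0)
    - (if d = o then nab c else 0)
  sum_x_nab : ∑ c, x c * nab c = -(lam • (1 : R))
  sum_x_xi : ∑ c, x c * xi c = 0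

/-- The Lie derivative along the quadratic Hamiltonian `x_a x_b`. -/
def quadLie (om : O → O → ℝ) (x nab xi eta : O → R) (a b : O) : R :=
  x a * raise om nab b + x b * raise om nab a - raise om xi b * eta a - raise om xi a * eta b

/-- The generalized contact Hamiltonian in homogeneous coordinates. -/
def homHam (om : O → O → ℝ) (nab xi : O → R) : R := ∑ a, raise om xi a * nab a

/-- Contraction with the contact form (times `-2`) in homogeneous coordinates. -/
def homContr (om : O → O → ℝ) (x eta : O → R) : R := ∑ a, raise om x a * eta a

namespace HomogWeyl

variable {o : O} {lam : ℝ} {x nab xi eta : O → R}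

/-- This and the following commutation rules are the relations of `HomogWeyl` contracted with `om`.
The terms carrying `om b o` come from the dependence of the index `o` on the others; they are what
later shifts the weight. -/
theorem eta_raise_xi (w : HomogWeyl o lam x nab xi eta) (a b : O) :
    eta a * raise om xi b = raise om xi b * eta a + om b a • 1 - om b o • x a := by
  simp only [raise, Finset.sum_mul, Finset.mul_sum, smul_mul_assoc, mul_smul_comm, w.ek, smul_add,
    smul_sub, Finset.sum_add_distrib, Finset.sum_sub_distrib, smul_ite, smul_zero]
  simp

theorem raise_nab_xi (w : HomogWeyl o lam x nab xi eta) (a b : O) :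
    raise om nab a * xi b = xi b * raise om nab a - (if b = o then raise om xi a else 0) := by
  simp only [raise, Finset.sum_mul, Finset.mul_sum, smul_mul_assoc, mul_smul_comm, w.nk,
    smul_sub, Finset.sum_sub_distrib, smul_ite, smul_zero]
  split_ifs <;> simp

theorem nab_raise_xi (w : HomogWeyl o lam x nab xi eta) (a b : O) :
    nab a * raise om xi b = raise om xi b * nab a - om b o • xi a := by
  simp only [raise, Finset.sum_mul, Finset.mul_sum, smul_mul_assoc, mul_smul_comm, w.nk,
    smul_sub, Finset.sum_sub_distrib, smul_ite, smul_zero]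
  simp

theorem raise_nab_raise_xi (w : HomogWeyl o lam x nab xi eta) (a b : O) :
    raise om nab a * raise om xi b = raise om xi b * raise om nab a - om b o • raise om xi a := by
  conv_lhs => rw [raise, Finset.sum_mul]
  simp only [smul_mul_assoc, w.nab_raise_xi, smul_sub, Finset.sum_sub_distrib]
  simp only [raise, Finset.mul_sum, mul_smul_comm, Finset.smul_sum, smul_comm (om b o)]

theorem nab_raise_x (w : HomogWeyl o lam x nab xi eta) (b a : O) :
    nab b * raise om x a = raise om x a * nab b + om a b • 1
      - (if b = o then raise om x a else 0) := by
  simp only [raise, Finset.sum_mul, Finset.mul_sum, smul_mul_assoc, mul_smul_comm, w.nx, smul_add,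
    smul_sub, Finset.sum_add_distrib, Finset.sum_sub_distrib, smul_ite, smul_zero]
  split_ifs <;> simp

theorem raise_nab_raise_x (w : HomogWeyl o lam x nab xi eta) (h : IsSymplectic om) (b a : O) :
    raise om nab b * raise om x a = raise om x a * raise om nab b + (if b = a then 1 else 0)
      - om b o • raise om x a := by
  conv_lhs => rw [raise, Finset.sum_mul]
  simp only [smul_mul_assoc, w.nab_raise_x, smul_sub, smul_add, Finset.sum_sub_distrib,
    Finset.sum_add_distrib, smul_smul, ← Finset.sum_smul, h.orthogonal', smul_ite, smul_zero]
  simp [raise, Finset.mul_sum]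

theorem raise_nab_nab (w : HomogWeyl o lam x nab xi eta) (b c : O) :
    raise om nab b * nab c = nab c * raise om nab b + om b o • nab c
      - (if c = o then raise om nab b else 0) := by
  simp only [raise, Finset.sum_mul, Finset.mul_sum, smul_mul_assoc, mul_smul_comm, w.nn _ c,
    smul_sub, smul_add, Finset.sum_sub_distrib, Finset.sum_add_distrib, smul_ite, smul_zero]
  split_ifs <;> simp

theorem eta_raise_x (w : HomogWeyl o lam x nab xi eta) (a b : O) :
    eta a * raise om x b = raise om x b * eta a := by
  simp only [raise, Finset.sum_mul, Finset.mul_sum, smul_mul_assoc, mul_smul_comm, w.ex]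

theorem xi_raise_x (w : HomogWeyl o lam x nab xi eta) (a b : O) :
    xi a * raise om x b = raise om x b * xi a := by
  simp only [raise, Finset.sum_mul, Finset.mul_sum, smul_mul_assoc, mul_smul_comm, w.kx]

theorem x_raise_x (w : HomogWeyl o lam x nab xi eta) (a b : O) :
    x a * raise om x b = raise om x b * x a := by
  simp only [raise, Finset.sum_mul, Finset.mul_sum, smul_mul_assoc, mul_smul_comm, w.xx a]

theorem raise_xi_x (w : HomogWeyl o lam x nab xi eta) (a b : O) :
    raise om xi a * x b = x b * raise om xi a := by
  simp only [raise, Finset.sum_mul, Finset.mul_sum, smul_mul_assoc, mul_smul_comm, w.kx]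

theorem raise_xi_raise_x (w : HomogWeyl o lam x nab xi eta) (a b : O) :
    raise om xi a * raise om x b = raise om x b * raise om xi a := by
  conv_lhs => rw [raise, Finset.sum_mul]
  simp only [smul_mul_assoc, w.xi_raise_x, ← mul_smul_comm, ← Finset.mul_sum]
  rfl

theorem raise_xi_raise_xi (w : HomogWeyl o lam x nab xi eta) (a b : O) :
    raise om xi a * raise om xi b = raise om xi b * raise om xi a := by
  simp only [raise, Finset.sum_mul, Finset.mul_sum, smul_mul_assoc, mul_smul_comm,
    Finset.smul_sum]
  rw [Finset.sum_comm]
  refine Finset.sum_congr rfl fun i _ => Finset.sum_congr rfl fun j _ => ?_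
  rw [w.kk, smul_comm]

theorem sum_raise_x_raise_nab (w : HomogWeyl o lam x nab xi eta) (h : IsSymplectic om) :
    ∑ a, raise om x a * raise om nab a = -(lam • (1 : R)) := by
  rw [sum_raise_mul_raise h, w.sum_x_nab]

/-- The bracket of `∂_b` with the contraction. -/
theorem nab_homContr (w : HomogWeyl o lam x nab xi eta) (h : IsSymplectic om) (b : O) :
    nab b * homContr om x eta = homContr om x eta * nab b - raise om eta b
      - (if b = o then homContr om x eta else 0) := by
  simp only [homContr, Finset.mul_sum, Finset.sum_mul, ← mul_assoc, w.nab_raise_x, sub_mul,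
    add_mul, Finset.sum_sub_distrib, Finset.sum_add_distrib]
  have h1 : ∑ a, om a b • (1 : R) * eta a = -raise om eta b := by
    rw [raise, ← Finset.sum_neg_distrib]
    exact Finset.sum_congr rfl fun a _ => by rw [h.antisymm a b]; simp
  have h2 : ∑ a, raise om x a * nab b * eta a = ∑ a, raise om x a * eta a * nab b :=
    Finset.sum_congr rfl fun a _ => by rw [mul_assoc, mul_assoc, w.en]
  rw [h1, h2]
  split_ifs <;> simp [sub_eq_add_neg]

theorem homContr_raise_xi (w : HomogWeyl o lam x nab xi eta) (h : IsSymplectic om) (b : O) :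
    homContr om x eta * raise om xi b = raise om xi b * homContr om x eta - x b := by
  have h0 : ∑ a, raise om x a * x a = 0 := by
    rw [← neg_inj, ← sum_mul_raise h.antisymm, sum_mul_raise_self h.antisymm _ w.xx, neg_zero]
  have h1 : ∑ a, om b a • raise om x a = -x b := by
    rw [← raise_raise h x b]; rfl
  have h2 : ∑ a, raise om x a * raise om xi b * eta a
      = ∑ a, raise om xi b * raise om x a * eta a :=
    Finset.sum_congr rfl fun a _ => by rw [w.raise_xi_raise_x]
  simp only [homContr, Finset.sum_mul, mul_assoc, w.eta_raise_xi, mul_sub, mul_add,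
    Finset.sum_sub_distrib, Finset.sum_add_distrib, mul_smul_comm, mul_one, h1, ← Finset.smul_sum,
    h0, Finset.mul_sum]
  simp only [← mul_assoc, h2]
  simp [sub_eq_add_neg]

theorem homContr_eta (w : HomogWeyl o lam x nab xi eta) (a : O) :
    homContr om x eta * eta a = eta a * homContr om x eta := by
  simp only [homContr, Finset.sum_mul, Finset.mul_sum, ← mul_assoc, w.eta_raise_x]
  exact Finset.sum_congr rfl fun b _ => by rw [mul_assoc, mul_assoc, w.ee]

theorem homContr_x (w : HomogWeyl o lam x nab xi eta) (a : O) :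
    homContr om x eta * x a = x a * homContr om x eta := by
  simp only [homContr, Finset.sum_mul, Finset.mul_sum, ← mul_assoc, w.x_raise_x]
  exact Finset.sum_congr rfl fun b _ => by rw [mul_assoc, mul_assoc, w.ex]

theorem homHam_x (w : HomogWeyl o lam x nab xi eta) (a : O) :
    homHam om nab xi * x a = x a * homHam om nab xi + raise om xi a - x a * raise om xi o := by
  simp only [homHam, Finset.sum_mul, mul_assoc, w.nx, mul_add, mul_sub, Finset.sum_add_distrib,
    Finset.sum_sub_distrib, Finset.mul_sum]
  simp only [← mul_assoc, w.raise_xi_x]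
  simp [w.raise_xi_x]

theorem sum_raise_xi_mul_xi (w : HomogWeyl o lam x nab xi eta) (h : IsSymplectic om) :
    ∑ c, raise om xi c * xi c = 0 := by
  rw [← neg_inj, ← sum_mul_raise h.antisymm, sum_mul_raise_self h.antisymm _ w.kk, neg_zero]

/-- Moving `nab b` to the left of the contraction produces the fibre Euler operator from the
bracket, and one extra term from `b = o`. Adding `raise om xi o` to `homHam` amounts to replacing
`lam` by `lam - 1`. -/
theorem homContr_homHam_aux (w : HomogWeyl o lam x nab xi eta) (h : IsSymplectic om) :
    ∑ b, raise om xi b * homContr om x eta * nab b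
      = (homHam om nab xi + raise om xi o) * homContr om x eta + ∑ c, xi c * eta c := by
  have h1 : ∀ b, homContr om x eta * nab b = nab b * homContr om x eta + raise om eta b
      + (if b = o then homContr om x eta else 0) := fun b => by
    rw [w.nab_homContr h]; abel
  simp only [mul_assoc, h1, mul_add, Finset.sum_add_distrib, sum_raise_mul_raise h, homHam,
    Finset.sum_mul, add_mul]
  simp
  abel

/-- The relation between the contraction and the generalized contact Hamiltonian. -/
theorem homContr_homHam (w : HomogWeyl o lam x nab xi eta) (h : IsSymplectic om) :
    homContr om x eta * homHam om nab xi
      = (homHam om nab xi + raise om xi o) * homContr om x eta + ∑ c, xi c * eta c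
        + lam • (1 : R) := by
  have h1 : homContr om x eta * homHam om nab xi
      = ∑ b, raise om xi b * homContr om x eta * nab b - ∑ b, x b * nab b := by
    rw [homHam, Finset.mul_sum, ← Finset.sum_sub_distrib]
    exact Finset.sum_congr rfl fun b _ => by
      rw [← mul_assoc, w.homContr_raise_xi h, sub_mul]
  rw [h1, w.homContr_homHam_aux h, w.sum_x_nab]
  simp

/-- The Lie derivatives intertwine the contraction, up to the change of the weight. -/
theorem quadLie_homContr (w : HomogWeyl o lam x nab xi eta) (h : IsSymplectic om) (a b : O) :
    quadLie om x nab xi eta a b * homContr om x eta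
      = homContr om x eta * quadLie om x nab xi eta a b
        - (om b o • x a + om a o • x b) * homContr om x eta := by
  have hD : ∀ b, raise om nab b * homContr om x eta
      = homContr om x eta * raise om nab b + eta b - om b o • homContr om x eta := fun b => by
    have h1 : eta b = -raise om (raise om eta) b := by rw [raise_raise h, neg_neg]
    rw [h1]
    conv_lhs => rw [raise, Finset.sum_mul]
    simp only [smul_mul_assoc, w.nab_homContr h, smul_sub, Finset.sum_sub_distrib, smul_ite,
      smul_zero, ← mul_smul_comm, ← Finset.mul_sum]
    simp [raise, sub_eq_add_neg]
  have hx : ∀ a b, x a * raise om nab b * homContr om x eta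
      = homContr om x eta * (x a * raise om nab b) + x a * eta b
        - om b o • x a * homContr om x eta := fun a b => by
    rw [mul_assoc, hD, mul_sub, mul_add, ← mul_assoc, ← w.homContr_x, mul_assoc, mul_smul_comm,
      smul_mul_assoc]
  have hz : ∀ a b, raise om xi b * eta a * homContr om x eta
      = homContr om x eta * (raise om xi b * eta a) + x b * eta a := fun a b => by
    rw [mul_assoc, ← w.homContr_eta, ← mul_assoc, ← mul_assoc, w.homContr_raise_xi h, sub_mul]
    abel
  -- The terms `x a * eta b` and `x b * eta a` created by the base derivatives cancel those created
  -- by the fibre part; only the weight correction survives.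
  simp only [quadLie, sub_mul, add_mul, mul_sub, mul_add, hx, hz]
  abel

/-- The Lie derivatives intertwine the generalized Hamiltonian, up to the change of the weight. -/
theorem quadLie_homHam (w : HomogWeyl o lam x nab xi eta) (h : IsSymplectic om) (a b : O) :
    quadLie om x nab xi eta a b * homHam om nab xi
      = homHam om nab xi * quadLie om x nab xi eta a b
        + (om b o • x a + om a o • x b) * homHam om nab xi := by
  have h0 : ∀ b, ∑ c, om c b • nab c = -raise om nab b := fun b => by
    rw [raise, ← Finset.sum_neg_distrib]
    exact Finset.sum_congr rfl fun c _ => by rw [h.antisymm c b, neg_smul]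
  have hD : ∀ b, raise om nab b * homHam om nab xi
      = homHam om nab xi * raise om nab b + raise om xi b * raise om nab o
        + om b o • homHam om nab xi - raise om xi o * raise om nab b := fun b => by
    have h1 : ∀ c, raise om nab b * (raise om xi c * nab c)
        = raise om xi c * nab c * raise om nab b + om b o • (raise om xi c * nab c)
          - (if c = o then raise om xi c * raise om nab b else 0)
          - raise om xi b * (om c o • nab c) := fun c => by
      rw [← mul_assoc, w.raise_nab_raise_xi, sub_mul, mul_assoc, w.raise_nab_nab, mul_sub, mul_add,
        mul_ite, mul_zero, smul_mul_assoc, mul_smul_comm, mul_smul_comm, mul_assoc]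
    simp only [homHam, Finset.mul_sum, Finset.sum_mul, h1, Finset.sum_sub_distrib,
      Finset.sum_add_distrib]
    rw [← Finset.mul_sum, h0, ← Finset.smul_sum]
    simp
    abel
  have hx : ∀ a b, x a * raise om nab b * homHam om nab xi
      = homHam om nab xi * (x a * raise om nab b) - raise om xi a * raise om nab b
        + x a * (raise om xi b * raise om nab o) + om b o • x a * homHam om nab xi := fun a b => by
    rw [← mul_assoc (homHam om nab xi), w.homHam_x, mul_assoc, hD]
    simp only [mul_sub, mul_add, sub_mul, add_mul, mul_smul_comm, smul_mul_assoc, mul_assoc]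
    abel
  have he : ∀ a, eta a * homHam om nab xi = homHam om nab xi * eta a - raise om nab a
      + x a * raise om nab o := fun a => by
    have h1 : ∀ c, eta a * (raise om xi c * nab c) = raise om xi c * nab c * eta a
        + om c a • nab c - x a * (om c o • nab c) := fun c => by
      rw [← mul_assoc, w.eta_raise_xi, sub_mul, add_mul, smul_mul_assoc, smul_mul_assoc, one_mul,
        mul_assoc, w.en, mul_assoc, mul_smul_comm]
    simp only [homHam, Finset.mul_sum, Finset.sum_mul, h1, Finset.sum_sub_distrib,
      Finset.sum_add_distrib]
    rw [← Finset.mul_sum, h0, h0]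
    simp [sub_eq_add_neg]
  have hzX : ∀ b, raise om xi b * homHam om nab xi = homHam om nab xi * raise om xi b := fun b => by
    have h1 : ∀ c, raise om xi c * nab c * raise om xi b = raise om xi b * (raise om xi c * nab c)
        - om b o • (raise om xi c * xi c) := fun c => by
      rw [mul_assoc, w.nab_raise_xi, mul_sub, ← mul_assoc, w.raise_xi_raise_xi, mul_assoc,
        mul_smul_comm]
    simp only [homHam, Finset.mul_sum, Finset.sum_mul, h1, Finset.sum_sub_distrib]
    rw [← Finset.smul_sum, w.sum_raise_xi_mul_xi h, smul_zero, sub_zero]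
  have hz : ∀ a b, raise om xi b * eta a * homHam om nab xi
      = homHam om nab xi * (raise om xi b * eta a) - raise om xi b * raise om nab a
        + x a * (raise om xi b * raise om nab o) := fun a b => by
    rw [mul_assoc, he, mul_add, mul_sub, ← mul_assoc, hzX, mul_assoc, ← mul_assoc _ (x a),
      w.raise_xi_x, mul_assoc (x a)]
  -- Likewise the products of `raise om xi` with `raise om nab`, including those with `raise om nab
  -- o`, cancel between `hx` and `hz`.
  simp only [quadLie, sub_mul, add_mul, mul_sub, mul_add, hx, hz]
  abel

theorem sum_raise_quadLie (h : IsSymplectic om) (a b : O) :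
    ∑ c, ∑ d, (om a c * om b d) • quadLie om x nab xi eta c d
      = -(raise om x a * nab b) - raise om x b * nab a + xi b * raise om eta a
        + xi a * raise om eta b := by
  have h1 : ∀ (F G : O → R) (a b : O), ∑ c, ∑ d, (om a c * om b d) • (F c * G d)
      = raise om F a * raise om G b := fun F G a b => by
    simp only [raise, Finset.sum_mul, Finset.mul_sum, smul_mul_assoc, mul_smul_comm, smul_smul,
      Finset.smul_sum]
    rw [Finset.sum_comm]
    simp only [mul_comm]
  have h2 : ∀ (F G : O → R) (a b : O), ∑ c, ∑ d, (om a c * om b d) • (F d * G c)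
      = raise om F b * raise om G a := fun F G a b => by
    rw [Finset.sum_comm, ← h1]
    simp only [mul_comm]
  simp only [quadLie, smul_sub, smul_add, Finset.sum_sub_distrib, Finset.sum_add_distrib, h1, h2,
    raise_raise h]
  simp only [mul_neg, neg_mul]
  abel

/-- The quadratic Casimir element. -/
theorem sum_quadLie_mul_quadLie (w : HomogWeyl o lam x nab xi eta) (h : IsSymplectic om) :
    ∑ a, ∑ b, ∑ c, ∑ d, (om a c * om b d) • (quadLie om x nab xi eta a b
        * quadLie om x nab xi eta c d)
      = (2 : ℝ) • ((2 : ℝ) • ((homHam om nab xi + raise om xi o) * homContr om x eta)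
        + (lam - lam * (lam - Fintype.card O + 1)) • (1 : R)
        - (∑ c, xi c * eta c) * (∑ c, xi c * eta c)
        - ((Fintype.card O : ℝ) - 2) • ∑ c, xi c * eta c) := by
  set X := homHam om nab xi with hX
  set A := homContr om x eta with hA
  set E := ∑ c, xi c * eta c with hE
  have hE' : ∑ a, raise om xi a * raise om eta a = E := sum_raise_mul_raise h _ _
  have hxe : ∑ a, x a * raise om eta a = -A := sum_mul_raise h.antisymm _ _
  have hxx : ∑ a, x a * raise om x a = 0 := sum_mul_raise_self h.antisymm _ w.xx
  have hax : ∑ a, om a o • raise om x a = 1 := by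
    have := raise_raise h x o
    rw [w.x_o, raise] at this
    rw [← neg_inj, ← this, ← Finset.sum_neg_distrib]
    exact Finset.sum_congr rfl fun a _ => by rw [h.antisymm a o, neg_smul, neg_neg]
  have hxnab : ∑ b, x b * nab b = -(lam • (1 : R)) := w.sum_x_nab
  -- By symmetry in `a`, `b` only half of the raised factor is needed, which leaves the eight
  -- products `t1` to `t8`. Each is reordered until a sum over a single index collapses by an Euler
  -- relation or by antisymmetry.
  have t1 : ∑ a, ∑ b, x a * raise om nab b * (raise om x a * nab b) = -(lam • (1 : R)) := by
    rw [Finset.sum_comm, ← hxnab]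
    refine Finset.sum_congr rfl fun b _ => ?_
    have : ∀ a, x a * raise om nab b * (raise om x a * nab b)
        = x a * raise om x a * (raise om nab b * nab b) + (if b = a then x a * nab b else 0)
          - x a * raise om x a * (om b o • nab b) := fun a => by
      rw [mul_assoc, ← mul_assoc (raise om nab b), w.raise_nab_raise_x h]
      simp only [sub_mul, add_mul, mul_sub, mul_add, mul_assoc, smul_mul_assoc, mul_smul_comm,
        ite_mul, mul_ite, zero_mul, mul_zero, one_mul]
    simp only [this, Finset.sum_add_distrib, Finset.sum_sub_distrib, ← Finset.sum_mul, hxx]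
    simp
  -- The inner sum over `a` and the outer sum over `b` are both Euler operators, hence a scalar
  -- quadratic in `lam`; the cardinality is the trace arising from the reordering.
  have t2 : ∑ a, ∑ b, x b * raise om nab a * (raise om x a * nab b)
      = (lam * (lam - Fintype.card O + 1)) • (1 : R) := by
    have h1 : ∑ a, raise om nab a * raise om x a = ((Fintype.card O : ℝ) - 1 - lam) • (1 : R) := by
      simp only [w.raise_nab_raise_x h, Finset.sum_add_distrib, Finset.sum_sub_distrib, hax,
        w.sum_raise_x_raise_nab h]
      simp only [if_true, Finset.sum_const, Finset.card_univ]
      rw [sub_smul, sub_smul, one_smul, Nat.cast_smul_eq_nsmul]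
      abel
    rw [Finset.sum_comm]
    have h2 : ∀ b, ∑ a, x b * raise om nab a * (raise om x a * nab b)
        = ((Fintype.card O : ℝ) - 1 - lam) • (x b * nab b) := fun b => by
      have : ∀ a, x b * raise om nab a * (raise om x a * nab b)
        = x b * (raise om nab a * raise om x a) * nab b := fun a => by simp only [mul_assoc]
      simp only [this, ← Finset.sum_mul, ← Finset.mul_sum, h1]
      simp
    simp only [h2, ← Finset.smul_sum, hxnab]
    module
  have t3 : ∑ a, ∑ b, raise om xi b * eta a * (raise om x a * nab b)
      = (X + raise om xi o) * A + E := by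
    rw [← w.homContr_homHam_aux h, Finset.sum_comm]
    refine Finset.sum_congr rfl fun b _ => ?_
    rw [homContr, Finset.mul_sum, Finset.sum_mul]
    refine Finset.sum_congr rfl fun a _ => ?_
    rw [← w.eta_raise_x]
    simp only [mul_assoc]
  have t4 : ∑ a, ∑ b, raise om xi a * eta b * (raise om x a * nab b) = 0 := by
    rw [Finset.sum_comm]
    refine Finset.sum_eq_zero fun b _ => ?_
    have h0 : ∑ a, raise om x a * raise om xi a = 0 := by
      rw [sum_raise_mul_raise h, w.sum_x_xi]
    have : ∀ a, raise om xi a * eta b * (raise om x a * nab b)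
        = raise om x a * raise om xi a * (eta b * nab b) := fun a => by
      rw [mul_assoc, ← mul_assoc (eta b), w.eta_raise_x, mul_assoc, ← mul_assoc,
        w.raise_xi_raise_x]
    simp only [this, ← Finset.sum_mul, h0, zero_mul]
  have t5 : ∑ a, ∑ b, x a * raise om nab b * (xi b * raise om eta a)
      = (X + raise om xi o) * A + raise om xi o * A + E := by
    have h1 : ∑ b, raise om nab b * xi b = -(X + raise om xi o) := by
      simp only [w.raise_nab_xi, Finset.sum_sub_distrib]
      rw [sum_mul_raise h.antisymm]
      simp only [Finset.sum_ite_eq', Finset.mem_univ, if_true]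
      rw [hX, homHam]
      abel
    have h2 : ∀ a, ∑ b, x a * raise om nab b * (xi b * raise om eta a)
        = raise om xi a * raise om eta a - (X + raise om xi o + raise om xi o)
          * (x a * raise om eta a) := fun a => by
      have : ∀ b, x a * raise om nab b * (xi b * raise om eta a)
        = x a * (raise om nab b * xi b) * raise om eta a := fun b => by simp only [mul_assoc]
      simp only [this, ← Finset.sum_mul, ← Finset.mul_sum, h1]
      have hXx : X * x a = x a * X + raise om xi a - x a * raise om xi o := w.homHam_x a
      rw [← mul_assoc (X + _ + _), add_mul _ _ (x a), add_mul _ _ (x a), hXx, w.raise_xi_x]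
      noncomm_ring
    simp only [h2, Finset.sum_sub_distrib, ← Finset.mul_sum, hxe, hE']
    noncomm_ring
  have t6 : ∑ a, ∑ b, x b * raise om nab a * (xi b * raise om eta a) = -E := by
    rw [← hE', ← Finset.sum_neg_distrib]
    refine Finset.sum_congr rfl fun a _ => ?_
    have : ∀ b, x b * raise om nab a * (xi b * raise om eta a)
        = x b * xi b * (raise om nab a * raise om eta a)
          - (if b = o then x b * (raise om xi a * raise om eta a) else 0) := fun b => by
      rw [mul_assoc, ← mul_assoc (raise om nab a), w.raise_nab_xi, sub_mul, mul_sub]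
      simp only [mul_assoc, mul_ite, ite_mul, mul_zero, zero_mul]
    simp only [this, Finset.sum_sub_distrib, ← Finset.sum_mul, w.sum_x_xi]
    simp [w.x_o]
  have t7 : ∑ a, ∑ b, raise om xi b * eta a * (xi b * raise om eta a)
      = E + raise om xi o * A := by
    have : ∀ a b, raise om xi b * eta a * (xi b * raise om eta a)
        = raise om xi b * xi b * (eta a * raise om eta a)
          + (if b = a then raise om xi b * raise om eta a else 0)
          - (if b = o then raise om xi b * (x a * raise om eta a) else 0) := fun a b => by
      rw [mul_assoc, ← mul_assoc (eta a), w.ek, sub_mul, mul_sub, add_mul, mul_add]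
      simp only [mul_assoc, mul_ite, ite_mul, mul_zero, zero_mul, one_mul]
    simp only [this, Finset.sum_sub_distrib, Finset.sum_add_distrib, ← Finset.sum_mul,
      w.sum_raise_xi_mul_xi h]
    simp [← Finset.mul_sum, hxe, hE']
  have t8 : ∑ a, ∑ b, raise om xi a * eta b * (xi b * raise om eta a)
      = E * E + ((Fintype.card O : ℝ) - 2) • E := by
    have h1 : ∑ b, eta b * xi b = E + ((Fintype.card O : ℝ) - 1) • (1 : R) := by
      simp only [w.ek, Finset.sum_sub_distrib, Finset.sum_add_distrib]
      simp only [if_true, Finset.sum_const, Finset.card_univ, Finset.sum_ite_eq', Finset.mem_univ,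
        w.x_o]
      rw [sub_smul, one_smul, Nat.cast_smul_eq_nsmul, add_sub_assoc]
    have h2 : ∀ a, eta a * E = E * eta a + eta a := fun a => by
      have : ∀ c, eta a * (xi c * eta c) = xi c * eta c * eta a
          + (if c = a then eta c else 0) - (if c = o then x a * eta c else 0) := fun c => by
        rw [← mul_assoc, w.ek, sub_mul, add_mul, mul_assoc, w.ee a c, mul_assoc]
        simp only [ite_mul, one_mul, zero_mul]
      simp only [hE, Finset.mul_sum, Finset.sum_mul, this, Finset.sum_sub_distrib,
        Finset.sum_add_distrib]
      simp [w.eta_o]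
    have h3 : ∀ a, E * raise om eta a = raise om eta a * E - raise om eta a := fun a => by
      simp only [raise, Finset.sum_mul, Finset.mul_sum, smul_mul_assoc, mul_smul_comm, h2,
        smul_add, Finset.sum_add_distrib]
      abel
    have h4 : ∀ a, ∑ b, raise om xi a * eta b * (xi b * raise om eta a)
        = raise om xi a * raise om eta a * E + ((Fintype.card O : ℝ) - 2) •
          (raise om xi a * raise om eta a) := fun a => by
      have : ∀ b, raise om xi a * eta b * (xi b * raise om eta a)
        = raise om xi a * (eta b * xi b) * raise om eta a := fun b => by simp only [mul_assoc]
      simp only [this, ← Finset.sum_mul, ← Finset.mul_sum, h1]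
      rw [mul_assoc, add_mul, h3, smul_mul_assoc, one_mul, mul_add, mul_sub, mul_smul_comm,
        mul_assoc]
      module
    simp only [h4, Finset.sum_add_distrib, ← Finset.sum_mul, ← Finset.smul_sum, hE']
  have hsymm : ∀ a b, quadLie om x nab xi eta a b = quadLie om x nab xi eta b a := fun a b => by
    simp only [quadLie]; abel
  -- The raised factor has two halves exchanged by swapping `a` and `b`; as `quadLie` is symmetric
  -- they contribute equally, whence the factor `2`.
  have hsum : ∑ a, ∑ b, ∑ c, ∑ d, (om a c * om b d) • (quadLie om x nab xi eta a b
        * quadLie om x nab xi eta c d)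
      = (2 : ℝ) • ∑ a, ∑ b, quadLie om x nab xi eta a b
        * (xi b * raise om eta a - raise om x a * nab b) := by
    simp only [← mul_smul_comm, ← Finset.mul_sum, sum_raise_quadLie h]
    have hs : ∑ a, ∑ b, quadLie om x nab xi eta a b
        * (xi b * raise om eta a - raise om x a * nab b)
        = ∑ a, ∑ b, quadLie om x nab xi eta a b
          * (xi a * raise om eta b - raise om x b * nab a) := by
      rw [Finset.sum_comm]
      exact Finset.sum_congr rfl fun a _ => Finset.sum_congr rfl fun b _ => by rw [hsymm]
    rw [two_smul]
    nth_rw 2 [hs]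
    simp only [← Finset.sum_add_distrib, ← mul_add]
    refine Finset.sum_congr rfl fun a _ => Finset.sum_congr rfl fun b _ => ?_
    congr 1
    abel
  rw [hsum]
  congr 1
  simp only [quadLie, mul_sub, sub_mul, add_mul, Finset.sum_sub_distrib, Finset.sum_add_distrib,
    t1, t2, t3, t4, t5, t6, t7, t8]
  module

end HomogWeyl

end HomogeneousWeyl

/-! ### The homogeneous operators realized on symbols. -/

section Operators

variable {n : ℕ}

theorem coeff_onCoeff (D : Vect n) (P : Pol n) (m : Idx n →₀ ℕ) :
    (onCoeff D P).coeff m = D (P.coeff m) := coeff_onCoeffFun D P m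

theorem onCoeff_monomial (D : Vect n) (m : Idx n →₀ ℕ) (f : Smooth n) :
    onCoeff D (MvPolynomial.monomial m f) = MvPolynomial.monomial m (D f) := by
  classical
  ext1 m'
  rw [coeff_onCoeff, MvPolynomial.coeff_monomial, MvPolynomial.coeff_monomial]
  split_ifs <;> simp

theorem onCoeff_cst_mul (D : Vect n) (f : Smooth n) (P : Pol n) :
    onCoeff D (cst f * P) = cst f * onCoeff D P + cst (D f) * P := by
  ext1 m
  simp only [coeff_onCoeff, MvPolynomial.coeff_C_mul, MvPolynomial.coeff_add, Derivation.leibniz,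
    smul_eq_mul]
  ring

theorem onCoeff_xi_mul (D : Vect n) (i : Idx n) (P : Pol n) :
    onCoeff D (xi i * P) = xi i * onCoeff D P := by
  classical
  ext1 m
  simp only [coeff_onCoeff, MvPolynomial.coeff_X_mul']
  split_ifs <;> simp

theorem onCoeff_dxi (D : Vect n) (i : Idx n) (P : Pol n) :
    onCoeff D (dxi i P) = dxi i (onCoeff D P) := by
  induction P using MvPolynomial.induction_on' with
  | monomial m f =>
    rw [dxi, MvPolynomial.pderiv_monomial, onCoeff_monomial, onCoeff_monomial, dxi,
      MvPolynomial.pderiv_monomial]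
    simp [mul_comm]
  | add P Q hP hQ => simp only [dxi, map_add] at *; rw [hP, hQ]

theorem onCoeff_smul_field (f : Smooth n) (D : Vect n) (P : Pol n) :
    onCoeff (f • D) P = cst f * onCoeff D P := by
  ext1 m
  simp [coeff_onCoeff, MvPolynomial.coeff_C_mul]

theorem onCoeff_pd_comm (i j : Idx n) (P : Pol n) :
    onCoeff (pd i) (onCoeff (pd j) P) = onCoeff (pd j) (onCoeff (pd i) P) := by
  ext1 m
  simp only [coeff_onCoeff]
  exact pd_comm i j _

/-- Multiplication by a homogeneous coordinate. -/
noncomputable def opX (a : Option (Idx n)) : Module.End ℝ (Pol n) := LinearMap.mulLeft ℝ (cst (xhat a))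

/-- Multiplication by a homogeneous fibre coordinate. -/
noncomputable def opXi : Option (Idx n) → Module.End ℝ (Pol n)
  | some i => LinearMap.mulLeft ℝ (xi i)
  | none => -∑ i, opX (some i) * LinearMap.mulLeft ℝ (xi i)

/-- Differentiation along a homogeneous fibre coordinate. -/
noncomputable def opEta : Option (Idx n) → Module.End ℝ (Pol n)
  | some i => (MvPolynomial.pderiv i).toLinearMap.restrictScalars ℝ
  | none => 0

/-- Differentiation along a homogeneous coordinate. -/
noncomputable def opNab (lam : ℝ) : Option (Idx n) → Module.End ℝ (Pol n)
  | some i => onCoeff (pd i)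
  | none => -(∑ i, opX (some i) * onCoeff (pd i)) - lam • 1

theorem opX_apply (a : Option (Idx n)) (P : Pol n) : opX a P = cst (xhat a) * P := rfl

theorem opXi_some_apply (i : Idx n) (P : Pol n) : opXi (some i) P = xi i * P := rfl

theorem opXi_none_apply (P : Pol n) :
    opXi none P = -∑ i, cst (coord i) * (xi i * P) := by
  simp [-Fintype.sum_sum_type, opXi, opX_apply, xhat, LinearMap.sum_apply]

theorem opEta_some_apply (i : Idx n) (P : Pol n) : opEta (some i) P = dxi i P := rfl

theorem opEta_none_apply (P : Pol n) : opEta none P = 0 := rfl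

theorem opNab_some_apply (lam : ℝ) (i : Idx n) (P : Pol n) :
    opNab lam (some i) P = onCoeff (pd i) P := rfl

theorem opNab_none_apply (lam : ℝ) (P : Pol n) :
    opNab lam none P = -(∑ i, cst (coord i) * onCoeff (pd i) P) - lam • P := by
  simp [-Fintype.sum_sum_type, opNab, opX_apply, xhat, LinearMap.sum_apply]

theorem pd_xhat (i : Idx n) (a : Option (Idx n)) :
    pd i (xhat a) = if some i = a then 1 else 0 := by
  rcases a with _ | j
  · simp [xhat]
  · simp [xhat, pd_coord, eq_comm]

theorem dxi_xi_mul (i j : Idx n) (P : Pol n) :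
    dxi i (xi j * P) = xi j * dxi i P + if j = i then P else 0 := by
  classical
  simp only [dxi, Derivation.leibniz, MvPolynomial.pderiv_X, smul_eq_mul, Pi.single_apply]
  by_cases h : j = i <;> simp [h]

theorem dxi_cst_mul (i : Idx n) (f : Smooth n) (P : Pol n) :
    dxi i (cst f * P) = cst f * dxi i P := by
  simp [dxi, Derivation.leibniz]

theorem cst_ite_mul (p : Prop) [Decidable p] (P : Pol n) :
    cst (if p then 1 else 0) * P = if p then P else 0 := by
  split_ifs <;> simp

theorem cst_sum_ite (a : Option (Idx n)) : ∑ i, coord i * (if some i = a then 1 else 0)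
    = xhat a - if none = a then 1 else 0 := by
  rcases a with _ | j
  · simp [xhat]
  · simp [xhat]

-- For indices `some i` these are the usual Weyl relations. The operators with index `none` are
-- defined so that the two Euler relations hold with `x_none = 1`, and the correction terms follow
-- by the Leibniz rule.
set_option maxHeartbeats 800000 in
theorem homogWeyl_op (n : ℕ) (lam : ℝ) :
    HomogWeyl (R := Module.End ℝ (Pol n)) none lam opX (opNab lam) opXi opEta where
  x_o := by refine LinearMap.ext fun P => ?_; simp [opX_apply, xhat]
  eta_o := rfl
  xx a b := by refine LinearMap.ext fun P => ?_; simp only [Module.End.mul_apply, opX_apply]; ring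
  ee a b := by
    refine LinearMap.ext fun P => ?_
    rcases a with _ | i <;> rcases b with _ | j <;>
      simp only [Module.End.mul_apply, opEta_none_apply, opEta_some_apply, map_zero]
    induction P using MvPolynomial.induction_on with
    | C f => simp
    | add P Q hP hQ => simp only [map_add, hP, hQ]
    | mul_X P l h =>
      have ha : ∀ (i : Idx n) (P Q : Pol n), dxi i (P + Q) = dxi i P + dxi i Q := fun i P Q =>
        map_add _ _ _
      rw [mul_comm, dxi_xi_mul, dxi_xi_mul, ha, ha, dxi_xi_mul, dxi_xi_mul, h]
      split_ifs <;> simp only [add_zero, dxi, map_zero]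
      abel
  kk a b := by
    refine LinearMap.ext fun P => ?_
    rcases a with _ | i <;> rcases b with _ | j <;>
      simp only [Module.End.mul_apply, opXi_none_apply, opXi_some_apply, Finset.mul_sum, mul_neg]
    · refine congrArg _ (Finset.sum_congr rfl fun i _ => ?_)
      ring
    · refine congrArg _ (Finset.sum_congr rfl fun i _ => ?_)
      ring
    · ring
  ex a b := by
    refine LinearMap.ext fun P => ?_
    rcases a with _ | i
    · simp [opEta_none_apply]
    · simp only [Module.End.mul_apply, opEta_some_apply, opX_apply, dxi_cst_mul]
  kx a b := by
    refine LinearMap.ext fun P => ?_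
    rcases a with _ | i
    · simp only [Module.End.mul_apply, opXi_none_apply, opX_apply, mul_neg, Finset.mul_sum]
      refine congrArg _ (Finset.sum_congr rfl fun i _ => ?_)
      ring
    · simp only [Module.End.mul_apply, opXi_some_apply, opX_apply]
      ring
  en a b := by
    refine LinearMap.ext fun P => ?_
    rcases a with _ | i <;> rcases b with _ | j <;>
      simp only [Module.End.mul_apply, opEta_none_apply, opEta_some_apply, opNab_none_apply,
        opNab_some_apply, map_zero, onCoeff_dxi, map_sub, map_neg, map_sum, dxi_cst_mul,
        Finset.sum_const_zero, neg_zero, sub_zero]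
    rw [dxi, Derivation.map_smul_of_tower]
  nx c a := by
    refine LinearMap.ext fun P => ?_
    rcases c with _ | i
    · simp only [Module.End.mul_apply, opX_apply, opNab_none_apply, onCoeff_cst_mul, mul_add,
        LinearMap.sub_apply, LinearMap.add_apply, Finset.sum_add_distrib, pd_xhat]
      have h1 : ∑ i, cst (coord i) * (cst (if some i = a then 1 else 0) * P)
          = cst (xhat a) * P - (if none = a then 1 else 0 : Module.End ℝ (Pol n)) P := by
        simp only [← mul_assoc, ← Finset.sum_mul, ← map_mul, ← map_sum, cst_sum_ite]
        split_ifs <;> simp [sub_mul]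
      rw [h1]
      simp only [mul_neg, mul_sub, mul_smul_comm, Finset.mul_sum, if_true, opX_apply]
      simp only [mul_left_comm (cst (xhat a))]
      abel
    · simp only [Module.End.mul_apply, opX_apply, opNab_some_apply, onCoeff_cst_mul,
        LinearMap.sub_apply, LinearMap.add_apply, pd_xhat]
      split_ifs <;> simp_all
  ek a c := by
    refine LinearMap.ext fun P => ?_
    rcases a with _ | i
    · rcases c with _ | j <;> simp [opEta_none_apply, opX_apply, xhat]
    · rcases c with _ | j
      · simp only [Module.End.mul_apply, opEta_some_apply, opXi_none_apply, map_neg, map_sum,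
          dxi_cst_mul, dxi_xi_mul, mul_add, Finset.sum_add_distrib, LinearMap.sub_apply,
          LinearMap.add_apply]
        simp [-Fintype.sum_sum_type, opX_apply, xhat]
        abel
      · simp only [Module.End.mul_apply, opEta_some_apply, opXi_some_apply, dxi_xi_mul,
          LinearMap.sub_apply, LinearMap.add_apply]
        split_ifs <;> simp_all
  nk c d := by
    refine LinearMap.ext fun P => ?_
    rcases c with _ | i <;> rcases d with _ | j <;>
      simp only [Module.End.mul_apply, opNab_none_apply, opNab_some_apply, opXi_none_apply,
        opXi_some_apply, map_neg, map_sum, onCoeff_cst_mul, onCoeff_xi_mul, pd_coord,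
        LinearMap.sub_apply, if_true, reduceCtorEq, if_false, sub_zero,
        mul_neg, mul_sub, Finset.mul_sum, mul_add, Finset.sum_add_distrib,
        mul_smul_comm, Finset.sum_neg_distrib, Finset.sum_sub_distrib,
        neg_sub]
    · simp only [cst_ite_mul, mul_ite, mul_zero, Finset.sum_ite_eq, Finset.mem_univ, if_true]
      have hs : ∀ i j : Idx n, cst (coord i) * (xi i * (cst (coord j) * onCoeff (pd j) P))
          = cst (coord j) * (cst (coord i) * (xi i * onCoeff (pd j) P)) := fun i j => by ring
      simp only [hs]
      abel
    · simp only [mul_left_comm (xi j)]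
    · simp only [cst_ite_mul, Finset.sum_ite_eq', Finset.mem_univ, if_true]
      abel
  nn c d := by
    refine LinearMap.ext fun P => ?_
    rcases c with _ | i <;> rcases d with _ | j <;>
      simp only [Module.End.mul_apply, opNab_none_apply, opNab_some_apply, map_neg, map_sum,
        onCoeff_cst_mul, pd_coord, onCoeff_pd_comm, LinearMap.add_apply,
        LinearMap.sub_apply, if_true, reduceCtorEq, if_false, LinearMap.zero_apply, sub_zero,
        mul_add, Finset.sum_add_distrib, smul_neg,
        Finset.smul_sum, Finset.sum_neg_distrib, Finset.sum_sub_distrib,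
        smul_sub, neg_sub, map_sub, map_smul]
    · abel
    · simp only [cst_ite_mul, Finset.sum_ite_eq', Finset.mem_univ, if_true]
      abel
    · simp only [cst_ite_mul, Finset.sum_ite_eq', Finset.mem_univ, if_true]
      abel
    · rw [add_zero]
  sum_x_nab := by
    refine LinearMap.ext fun P => ?_
    rw [Fintype.sum_option]
    simp [-Fintype.sum_sum_type, LinearMap.sum_apply, opX_apply, opNab_none_apply, opNab_some_apply, xhat]
    abel
  sum_x_xi := by
    refine LinearMap.ext fun P => ?_
    rw [Fintype.sum_option]
    simp [-Fintype.sum_sum_type, LinearMap.sum_apply, opX_apply, opXi_none_apply, opXi_some_apply, xhat]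

end Operators
-- Quadratic contact Hamiltonians and their Lie derivatives in homogeneous coordinates.
section Symplectic

variable {n : ℕ}

/-- The matrix of the symplectic form in the homogeneous coordinates. -/
def omega (n : ℕ) : Option (Idx n) → Option (Idx n) → ℝ
  | some (.inl i), some (.inr (.inl j)) => if i = j then 1 else 0
  | some (.inr (.inl i)), some (.inl j) => if i = j then -1 else 0
  | some (.inr (.inr _)), none => 1
  | none, some (.inr (.inr _)) => -1
  | _, _ => 0

theorem isSymplectic_omega (n : ℕ) : IsSymplectic (omega n) where
  antisymm := by
    rintro (_ | i | i | i) (_ | j | j | j) <;> simp [omega, eq_comm] <;> split_ifs <;> simp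
  orthogonal := by
    rintro (_ | i | i | i) (_ | j | j | j) <;> simp [omega, Fintype.sum_option]
    all_goals split_ifs <;> simp_all

/-- The components of the field `contactField (xhat a) + xhat a • pd it`. -/
noncomputable def comp (a c : Option (Idx n)) : Smooth n :=
  algebraMap ℝ (Smooth n) (omega n a c) - algebraMap ℝ (Smooth n) (omega n a none) * xhat c

/-- The right-hand side is the constant Hamiltonian field of a linear function on `ℝ^{2n+2}`,
corrected by a multiple of the Euler field to stay on the chart `x_none = 1`. The summand with `pd
it` is there because `-2h ∂_t` is not a derivation in `h`: for a product it is shared equally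
between the factors. -/
theorem contactField_xhat (a c : Option (Idx n)) :
    contactField (xhat a) (xhat c) + xhat a * pd it (xhat c) = comp a c := by
  revert a c
  rintro (_ | i | i | i) (_ | j | j | j) <;>
    simp only [comp, omega, xhat, contactField_apply, eulerS_ip, eulerS_iq, eulerS_it, pd_coord]
  all_goals simp
  all_goals try split_ifs
  all_goals try simp
  all_goals try ring

theorem contactField_xhat_mul (a b c : Option (Idx n)) :
    contactField (xhat a * xhat b) (xhat c) = xhat a * comp b c + xhat b * comp a c := by
  rw [contactField_mul, contactField_xhat, contactField_xhat]

theorem lie_contactField_xhat_mul (a b c d : Option (Idx n)) :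
    ⁅contactField (xhat a * xhat b), contactField (xhat c * xhat d)⁆
      = omega n a c • contactField (xhat b * xhat d) + omega n a d • contactField (xhat b * xhat c)
        + omega n b c • contactField (xhat a * xhat d)
        + omega n b d • contactField (xhat a * xhat c) := by
  simp only [← map_smul, ← map_add]
  refine IsComb.ext ((isComb_contactField _).lie (isComb_contactField _))
    (isComb_contactField _) fun i => ?_
  have hi : coord i = xhat (some i) := rfl
  rw [Derivation.commutator_apply, hi]
  simp only [map_add, map_smul, Derivation.add_apply, Derivation.smul_apply,
    contactField_xhat_mul, comp, map_sub, Derivation.leibniz, smul_eq_mul,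
    Derivation.map_algebraMap]
  simp only [Algebra.smul_def]
  have hom := (isSymplectic_omega n).antisymm
  rw [hom c a, hom c b, hom d a, hom d b]
  simp only [map_neg]
  ring

theorem cst_algebraMap_mul (c : ℝ) (P : Pol n) : cst (algebraMap ℝ (Smooth n) c) * P = c • P := by
  ext1 m
  rw [MvPolynomial.coeff_C_mul, MvPolynomial.coeff_smul, Algebra.smul_def]

theorem onCoeff_eq_sum {D : Vect n} (hD : IsComb D) (P : Pol n) :
    onCoeff D P = ∑ i, cst (D (coord i)) * onCoeff (pd i) P := by
  ext1 m
  simp only [MvPolynomial.coeff_sum, MvPolynomial.coeff_C_mul, coeff_onCoeff]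
  exact hD _

theorem cst_comp_mul (a c : Option (Idx n)) (P : Pol n) :
    cst (comp a c) * P = omega n a c • P - omega n a none • (cst (xhat c) * P) := by
  rw [comp, cst, MvPolynomial.C_sub, MvPolynomial.C_mul, sub_mul, mul_assoc, cst_algebraMap_mul, cst_algebraMap_mul]

/-- The parameter `lam` enters only through `∂_none`; the other part of `∂_none` turns the constants
`omega n b (some i)` into the components `comp`. -/
theorem raise_opNab_apply (lam : ℝ) (b : Option (Idx n)) (P : Pol n) :
    raise (omega n) (opNab lam) b P = ∑ i, cst (comp b (some i)) * onCoeff (pd i) P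
      - (omega n b none * lam) • P := by
  rw [raise, Fintype.sum_option]
  simp only [LinearMap.add_apply, LinearMap.sum_apply, LinearMap.smul_apply, opNab_none_apply,
    opNab_some_apply, cst_comp_mul, Finset.sum_sub_distrib, ← Finset.smul_sum, smul_sub, smul_neg,
    smul_smul, xhat]
  abel

theorem raise_opXi_apply (b : Option (Idx n)) (P : Pol n) :
    raise (omega n) opXi b P = ∑ i, cst (comp b (some i)) * (xi i * P) := by
  rw [raise, Fintype.sum_option]
  simp only [LinearMap.add_apply, LinearMap.sum_apply, LinearMap.smul_apply, opXi_none_apply,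
    opXi_some_apply, cst_comp_mul, Finset.sum_sub_distrib, ← Finset.smul_sum, smul_neg, xhat]
  abel

theorem sum_xi_mul_dxi {k : ℕ} {P : Pol n} (hP : P ∈ Symb n k) :
    ∑ i, xi i * dxi i P = (k : ℝ) • P := by
  have := (mem_symb.1 hP).sum_X_mul_pderiv
  rw [this, Nat.cast_smul_eq_nsmul]

theorem pd_comp (j i : Idx n) (b : Option (Idx n)) :
    pd j (comp b (some i))
      = -algebraMap ℝ (Smooth n) (omega n b none) * if i = j then 1 else 0 := by
  simp only [comp, map_sub, Derivation.leibniz, Derivation.map_algebraMap, pd_xhat, smul_eq_mul,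
    Option.some.injEq, eq_comm (a := j)]
  ring

theorem sum_cst_pd_mul_xi_mul_dxi {k : ℕ} {P : Pol n} (hP : P ∈ Symb n k)
    (a b : Option (Idx n)) :
    ∑ i, ∑ j, cst (pd j (xhat a * comp b (some i))) * xi i * dxi j P
      = raise (omega n) opXi b (opEta a P) - (k * omega n b none) • (cst (xhat a) * P) := by
  have h1 : ∑ i, ∑ j, cst (if some j = a then 1 else 0) * (cst (comp b (some i)) * (xi i * dxi j P))
      = raise (omega n) opXi b (opEta a P) := by
    rw [raise_opXi_apply]
    refine Finset.sum_congr rfl fun i _ => ?_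
    simp only [cst_ite_mul]
    rcases a with _ | l
    · simp [opEta_none_apply]
    · simp [-Fintype.sum_sum_type, opEta_some_apply]
  have h2 : ∑ i, ∑ j, cst (xhat a) * (cst (algebraMap ℝ (Smooth n) (omega n b none))
        * (cst (if i = j then 1 else 0) * (xi i * dxi j P)))
      = (k * omega n b none) • (cst (xhat a) * P) := by
    simp only [cst_ite_mul, cst_algebraMap_mul, ← Finset.mul_sum, ← Finset.smul_sum,
      Finset.sum_ite_eq, Finset.mem_univ, if_true, sum_xi_mul_dxi hP]
    rw [smul_smul, mul_smul_comm, mul_comm]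
  rw [← h1, ← h2, ← Finset.sum_sub_distrib]
  refine Finset.sum_congr rfl fun i _ => ?_
  rw [← Finset.sum_sub_distrib]
  refine Finset.sum_congr rfl fun j _ => ?_
  rw [Derivation.leibniz, pd_comp, pd_xhat]
  simp only [smul_eq_mul, map_add, map_mul, map_neg]
  ring

theorem sum_pd_comp (a b : Option (Idx n)) :
    ∑ i, pd i (xhat a * comp b (some i))
      = algebraMap ℝ (Smooth n) (omega n b a)
        - algebraMap ℝ (Smooth n) ((2 * n + 2) * omega n b none) * xhat a := by
  have h1 : ∑ i, comp b (some i) * (if some i = a then 1 else 0) = comp b a := by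
    rcases a with _ | l
    · simp [comp, xhat]
    · simp [-Fintype.sum_sum_type]
  simp only [Derivation.leibniz, pd_comp, pd_xhat, smul_eq_mul, if_true, mul_one,
    Finset.sum_add_distrib, h1, Finset.sum_const, Finset.card_univ]
  simp [comp, map_ofNat]
  ring

/-- On symbols, the Lie derivative along the Hamiltonian field of `x_a x_b`. -/
theorem lieTotal_contactField {k : ℕ} (w : ℝ) {P : Pol n} (hP : P ∈ Symb n k)
    (a b : Option (Idx n)) :
    lieTotal n w (contactField (xhat a * xhat b)) P
      = quadLie (omega n) opX (opNab (2 * (n + 1) * w - k)) opXi opEta a b P := by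
  have hc : ∀ i, contactField (xhat a * xhat b) (coord i)
      = xhat a * comp b (some i) + xhat b * comp a (some i) := fun i =>
    contactField_xhat_mul a b (some i)
  change onCoeff _ P - (∑ i, ∑ j, cst (pd j (contactField (xhat a * xhat b) (coord i))) * xi i
    * dxi j P) + w • (cst (∑ i, pd i (contactField (xhat a * xhat b) (coord i))) * P) = _
  have hcst : ∀ f g : Smooth n, cst (f + g) = cst f + cst g := fun f g => map_add _ f g
  have hA : onCoeff (contactField (xhat a * xhat b)) P
      = cst (xhat a) * ∑ i, cst (comp b (some i)) * onCoeff (pd i) P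
        + cst (xhat b) * ∑ i, cst (comp a (some i)) * onCoeff (pd i) P := by
    rw [onCoeff_eq_sum (isComb_contactField _), Finset.mul_sum, Finset.mul_sum,
      ← Finset.sum_add_distrib]
    refine Finset.sum_congr rfl fun i _ => ?_
    rw [hc, hcst, cst, MvPolynomial.C_mul, cst, MvPolynomial.C_mul]
    ring
  have hB : ∑ i, ∑ j, cst (pd j (contactField (xhat a * xhat b) (coord i))) * xi i * dxi j P
      = raise (omega n) opXi b (opEta a P) - (k * omega n b none) • (cst (xhat a) * P)
        + (raise (omega n) opXi a (opEta b P) - (k * omega n a none) • (cst (xhat b) * P)) := by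
    rw [← sum_cst_pd_mul_xi_mul_dxi hP, ← sum_cst_pd_mul_xi_mul_dxi hP, ← Finset.sum_add_distrib]
    refine Finset.sum_congr rfl fun i _ => ?_
    rw [← Finset.sum_add_distrib]
    refine Finset.sum_congr rfl fun j _ => ?_
    rw [hc, map_add, hcst, add_mul, add_mul]
  have hC : cst (∑ i, pd i (contactField (xhat a * xhat b) (coord i))) * P
      = -(((2 * n + 2) * omega n b none) • (cst (xhat a) * P))
        - ((2 * n + 2) * omega n a none) • (cst (xhat b) * P) := by
    simp only [hc, map_add, Finset.sum_add_distrib, sum_pd_comp]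
    -- The constant parts of the two divergences, `omega n b a` and `omega n a b`, cancel.
    rw [(isSymplectic_omega n).antisymm b a, ← cst_algebraMap_mul, ← cst_algebraMap_mul]
    simp only [cst, MvPolynomial.C_sub, MvPolynomial.C_mul, map_neg]
    ring
  -- The multiples of `x_a` coming from the fibre degree (`k`) and from the divergence (`-(2n+2)w`)
  -- add up to `-lam`, which is the contribution of `∂_none`; this fixes the choice of `lam`.
  rw [hA, hB, hC]
  simp only [quadLie, LinearMap.sub_apply, LinearMap.add_apply, Module.End.mul_apply,
    raise_opNab_apply, opX_apply, mul_sub, mul_smul_comm]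
  module

end Symplectic
-- The Killing form of `sp_{2n+2}` and its Casimir element.
section Killing

/-- The hypothesis says that the tensor `∑ v_α ⊗ u_α` inverts the Killing form, so its coordinate
matrix is a left inverse of the Gram matrix. The families need not be bases, and nondegeneracy is a
consequence. -/
theorem casimir_eq_sum {𝔤 M κ : Type*} [LieRing 𝔤] [LieAlgebra ℝ 𝔤] [Module.Finite ℝ 𝔤]
    [AddCommGroup M] [Module ℝ M] [Fintype κ] (ρ : 𝔤 →ₗ[ℝ] Module.End ℝ M) (u v : κ → 𝔤)
    (h : ∀ x, ∑ α, killingForm ℝ 𝔤 (u α) x • v α = x) :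
    casimir ρ = ∑ α, ρ (v α) * ρ (u α) := by
  set b := Module.finBasis ℝ 𝔤 with hb
  set G := Matrix.of fun i j => killingForm ℝ 𝔤 (b i) (b j) with hG
  have hinv : G⁻¹ = Matrix.of fun i j => ∑ α, b.repr (v α) i * b.repr (u α) j := by
    refine Matrix.inv_eq_left_inv ?_
    ext i l
    simp only [Matrix.mul_apply, Matrix.of_apply, hG, Finset.sum_mul, Matrix.one_apply]
    rw [Finset.sum_comm]
    have h1 : ∀ α, ∑ j, b.repr (v α) i * b.repr (u α) j * killingForm ℝ 𝔤 (b j) (b l)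
        = killingForm ℝ 𝔤 (u α) (b l) * b.repr (v α) i := fun α => by
      conv_rhs => rw [← b.sum_repr (u α)]
      simp only [map_sum, map_smul, LinearMap.sum_apply, LinearMap.smul_apply, smul_eq_mul,
        Finset.sum_mul]
      exact Finset.sum_congr rfl fun j _ => by ring
    have h2 := congrArg (fun y => b.repr y i) (h (b l))
    simp only [map_sum, map_smul, Finsupp.coe_finsetSum, Finset.sum_apply, Finsupp.smul_apply,
      smul_eq_mul, Module.Basis.repr_self, Finsupp.single_apply] at h2
    simp only [h1, h2, eq_comm]
  have h3 : ∀ i, ρ (∑ j, G⁻¹ i j • b j) = ∑ α, b.repr (v α) i • ρ (u α) := fun i => by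
    have : ∑ j, G⁻¹ i j • b j = ∑ α, b.repr (v α) i • u α := by
      simp only [hinv, Matrix.of_apply, Finset.sum_smul, mul_smul]
      rw [Finset.sum_comm]
      exact Finset.sum_congr rfl fun α _ => by rw [← Finset.smul_sum, b.sum_repr]
    rw [this, map_sum]
    simp only [map_smul]
  change ∑ i, ρ (b i) * ρ (∑ j, G⁻¹ i j • b j) = _
  simp only [h3, Finset.mul_sum, mul_smul_comm]
  rw [Finset.sum_comm]
  refine Finset.sum_congr rfl fun α _ => ?_
  conv_rhs => rw [← b.sum_repr (v α)]
  simp only [map_sum, map_smul, Finset.sum_mul, smul_mul_assoc]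

theorem trace_eq_sum_of_resolution {V κ : Type*} [AddCommGroup V] [Module ℝ V]
    [Module.Finite ℝ V] [Fintype κ] (θ : κ → V →ₗ[ℝ] ℝ) (v : κ → V)
    (h : ∀ x, ∑ α, θ α x • v α = x) (A : Module.End ℝ V) :
    LinearMap.trace ℝ V A = ∑ α, θ α (A (v α)) := by
  have hA : A = ∑ α, (θ α).smulRight (A (v α)) := by
    refine LinearMap.ext fun x => ?_
    conv_lhs => rw [← h x]
    simp [LinearMap.sum_apply]
  conv_lhs => rw [hA]
  simp

variable {n : ℕ}

/-- The contact Hamiltonian field of `x_a x_b`, as an element of `sp_{2n+2}`. -/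
noncomputable def spGen (a b : Option (Idx n)) : sp n :=
  ⟨contactField (xhat a * xhat b), ⟨_, Submodule.subset_span ⟨(a, b), rfl⟩, rfl⟩⟩

theorem spGen_comm (a b : Option (Idx n)) : spGen a b = spGen b a :=
  Subtype.ext (by simp only [spGen, mul_comm])

theorem lie_spGen (a b c d : Option (Idx n)) :
    ⁅spGen a b, spGen c d⁆ = omega n a c • spGen b d + omega n a d • spGen b c
      + omega n b c • spGen a d + omega n b d • spGen a c :=
  Subtype.ext (lie_contactField_xhat_mul a b c d)

theorem span_spGen (n : ℕ) :
    Submodule.span ℝ (Set.range fun a : Option (Idx n) × Option (Idx n) => spGen a.1 a.2) = ⊤ := by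
  refine eq_top_iff.2 fun x _ => ?_
  obtain ⟨_, h, hh, rfl⟩ := x
  have : ∀ h (hh : h ∈ polLeTwo n), (⟨contactField h, ⟨h, hh, rfl⟩⟩ : sp n) ∈
      Submodule.span ℝ (Set.range fun a : Option (Idx n) × Option (Idx n) => spGen a.1 a.2) := by
    intro h hh
    induction hh using Submodule.span_induction with
    | mem h hm =>
      obtain ⟨a, rfl⟩ := hm
      exact Submodule.subset_span ⟨a, rfl⟩
    | zero =>
      convert Submodule.zero_mem _
      exact Subtype.ext (map_zero _)
    | add f g hf hg h1 h2 =>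
      convert Submodule.add_mem _ h1 h2
      exact Subtype.ext (map_add _ _ _)
    | smul c f hf h1 =>
      convert Submodule.smul_mem _ c h1
      exact Subtype.ext (map_smul _ _ _)
  exact this h hh

/-- The contraction of vector fields with the contact form. -/
noncomputable def hamOf : Vect n →ₗ[ℝ] Smooth n where
  toFun D := (1 / 2 : ℝ) • (∑ j : Fin n, (coord (ip j) * D (coord (iq j))
    - coord (iq j) * D (coord (ip j))) - D (coord it))
  map_add' D E := by
    simp only [Derivation.add_apply, mul_add, ← smul_add, Finset.sum_add_distrib,
      Finset.sum_sub_distrib]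
    congr 1
    abel
  map_smul' c D := by
    simp only [Derivation.smul_apply, mul_smul_comm, ← smul_sub, ← Finset.smul_sum,
      RingHom.id_apply, smul_comm c]

/-- The Hamiltonian is recovered by pairing its field with the contact form. This makes coordinates
on `sp n` available through Taylor coefficients of the Hamiltonian. -/
theorem hamOf_contactField (h : Smooth n) : hamOf (contactField h) = h := by
  have h1 : ∑ j : Fin n, (coord (ip j) * contactField h (coord (iq j))
      - coord (iq j) * contactField h (coord (ip j))) = eulerS n h := by
    simp only [eulerS, vect_sum_apply]
    refine Finset.sum_congr rfl fun j _ => ?_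
    simp only [contactField_apply, eulerS_ip, eulerS_iq, pd_coord]
    simp
    ring
  have h2 : contactField h (coord it) = eulerS n h - 2 * h := by
    simp only [contactField_apply, eulerS_it, pd_coord]
    simp
  change (1 / 2 : ℝ) • (∑ j : Fin n, (coord (ip j) * contactField h (coord (iq j))
      - coord (iq j) * contactField h (coord (ip j))) - contactField h (coord it)) = h
  rw [h1, h2, sub_sub_cancel, Algebra.smul_def, ← map_ofNat (algebraMap ℝ (Smooth n)) 2,
    ← mul_assoc, ← map_mul]
  norm_num

/-- Evaluation at the origin. -/
noncomputable def evalZero : Smooth n →ₗ[ℝ] ℝ where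
  toFun f := f 0
  map_add' _ _ := rfl
  map_smul' _ _ := rfl

theorem evalZero_mul (f g : Smooth n) : evalZero (f * g) = evalZero f * evalZero g := rfl

theorem evalZero_xhat (a : Option (Idx n)) : evalZero (xhat a) = if none = a then 1 else 0 := by
  rcases a with _ | i <;> rfl

/-- The symmetric coefficients of a polynomial of degree at most two. -/
noncomputable def quadCoeff : Option (Idx n) → Option (Idx n) → Smooth n →ₗ[ℝ] ℝ
  | some i, some j => (1 / 2 : ℝ) • evalZero ∘ₗ (pd i : Smooth n →ₗ[ℝ] Smooth n)
      ∘ₗ (pd j : Smooth n →ₗ[ℝ] Smooth n)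
  | some i, none => (1 / 2 : ℝ) • evalZero ∘ₗ (pd i : Smooth n →ₗ[ℝ] Smooth n)
  | none, some i => (1 / 2 : ℝ) • evalZero ∘ₗ (pd i : Smooth n →ₗ[ℝ] Smooth n)
  | none, none => evalZero

theorem quadCoeff_xhat_mul (a b c d : Option (Idx n)) :
    quadCoeff a b (xhat c * xhat d) = 1 / 2 * ((if a = c then 1 else 0) * (if b = d then 1 else 0)
      + (if a = d then 1 else 0) * (if b = c then 1 else 0)) := by
  have h0 : ∀ p : Prop, [Decidable p] → evalZero (if p then 1 else 0 : Smooth n)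
      = if p then 1 else 0 := fun p _ => by split_ifs <;> rfl
  have hpd : ∀ (i : Idx n) (p : Prop) [Decidable p], pd i (if p then 1 else 0) = 0 :=
      fun i p _ => by
    split_ifs <;> simp
  rcases a with _ | i <;> rcases b with _ | j <;>
    simp only [quadCoeff, LinearMap.smul_apply, LinearMap.comp_apply, Derivation.coeFn_coe,
      Derivation.leibniz, map_add, smul_eq_mul, evalZero_mul, evalZero_xhat, pd_xhat, h0, hpd,
      map_zero, mul_zero]
  all_goals ring

/-- The coordinates of an element of `sp_{2n+2}` in the generators. -/
noncomputable def spCoord (a b : Option (Idx n)) : sp n →ₗ[ℝ] ℝ :=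
  quadCoeff a b ∘ₗ hamOf ∘ₗ (sp n).toSubmodule.subtype

theorem spCoord_spGen (a b c d : Option (Idx n)) :
    spCoord a b (spGen c d) = 1 / 2 * ((if a = c then 1 else 0) * (if b = d then 1 else 0)
      + (if a = d then 1 else 0) * (if b = c then 1 else 0)) := by
  rw [← quadCoeff_xhat_mul]
  change quadCoeff a b (hamOf (contactField _)) = _
  rw [hamOf_contactField]

theorem sp_hom_ext {V : Type*} [AddCommGroup V] [Module ℝ V] {f g : sp n →ₗ[ℝ] V}
    (h : ∀ a b, f (spGen a b) = g (spGen a b)) : f = g :=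
  LinearMap.ext_on (span_spGen n) (by rintro _ ⟨⟨a, b⟩, rfl⟩; exact h a b)

/-- The generators form an overcomplete family, since `(a, b)` and `(b, a)` give the same field. The
symmetrized coordinates, with their factor `1/2`, still resolve the identity, which suffices for
traces. -/
theorem sum_spCoord_smul (x : sp n) :
    ∑ α : Option (Idx n) × Option (Idx n), spCoord α.1 α.2 x • spGen α.1 α.2 = x := by
  have : ∑ α : Option (Idx n) × Option (Idx n), (spCoord α.1 α.2).smulRight (spGen α.1 α.2)
      = LinearMap.id := by
    refine sp_hom_ext fun c d => ?_
    simp only [LinearMap.sum_apply, LinearMap.smulRight_apply, LinearMap.id_apply]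
    rw [Fintype.sum_prod_type]
    simp only [spCoord_spGen, mul_add, add_smul, Finset.sum_add_distrib, mul_smul,
      ite_smul, one_smul, zero_smul, Finset.sum_ite_eq', Finset.mem_univ,
      if_true, smul_ite, smul_zero]
    rw [spGen_comm d c]
    module
  simpa [LinearMap.sum_apply] using LinearMap.congr_fun this x

/-- The constant is `2n+4`, the ratio of the Killing form of `sp_{2n+2}` to the trace form of the
defining representation, times the `-2` of that trace form on quadratic Hamiltonians. Here the trace
of the adjoint action is computed directly from the brackets. -/
theorem killingForm_spGen (a b c d : Option (Idx n)) :
    killingForm ℝ (sp n) (spGen a b) (spGen c d)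
      = -(4 * (n + 2)) * (omega n a c * omega n b d + omega n a d * omega n b c) := by
  have h := (isSymplectic_omega n).antisymm
  rw [killingForm_apply_apply, trace_eq_sum_of_resolution _ _ sum_spCoord_smul,
    Fintype.sum_prod_type]
  simp only [LinearMap.comp_apply, LieAlgebra.ad_apply, lie_spGen, map_add,
    map_smul, smul_eq_mul, spCoord_spGen, mul_add, Finset.sum_add_distrib]
  simp [-Fintype.sum_sum_type, -Fintype.sum_option]
  rw [h c b, h c a, h d b, h d a, h d c, h b a]
  ring

/-- The Casimir operator in terms of the generators. -/
theorem casimir_sp {M : Type*} [AddCommGroup M] [Module ℝ M] (ρ : sp n →ₗ[ℝ] Module.End ℝ M) :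
    casimir ρ = (-1 / (8 * (n + 2)) : ℝ) • ∑ a, ∑ b, ∑ c, ∑ d, (omega n a c * omega n b d) •
      (ρ (spGen a b) * ρ (spGen c d)) := by
  have hn : (n + 2 : ℝ) ≠ 0 := by positivity
  have ho := (isSymplectic_omega n).antisymm
  have horth : ∀ a e, ∑ c, omega n a c * omega n c e = if a = e then (-1 : ℝ) else 0 :=
      fun a e => by
    have := (isSymplectic_omega n).orthogonal a e
    rw [← neg_inj, ← Finset.sum_neg_distrib]
    simp only [ho _ a, neg_mul] at this
    rw [this]; split_ifs <;> simp
  have hK : ∀ a b e f, ∑ c, ∑ d, (omega n a c * omega n b d) *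
      killingForm ℝ (sp n) (spGen c d) (spGen e f)
      = -(4 * (n + 2)) * ((if a = e then 1 else 0) * (if b = f then 1 else 0)
        + (if a = f then 1 else 0) * (if b = e then 1 else 0)) := fun a b e f => by
    have h1 : ∀ e f, (∑ c, ∑ d, (omega n a c * omega n b d) * (omega n c e * omega n d f))
        = (if a = e then 1 else 0) * (if b = f then 1 else 0) := fun e f => by
      have : ∀ c d, (omega n a c * omega n b d) * (omega n c e * omega n d f)
          = (omega n a c * omega n c e) * (omega n b d * omega n d f) := fun c d => by ring
      simp only [this, ← Finset.mul_sum, ← Finset.sum_mul, horth]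
      split_ifs <;> simp
    rw [← h1 e f, ← h1 f e, ← Finset.sum_add_distrib, Finset.mul_sum]
    refine Finset.sum_congr rfl fun c _ => ?_
    rw [← Finset.sum_add_distrib, Finset.mul_sum]
    refine Finset.sum_congr rfl fun d _ => ?_
    rw [killingForm_spGen]
    ring
  -- By `hK`, pairing with the raised generators gives `-4(n+2)` times a symmetrized delta, while
  -- the coordinates require `1/2` times it; the quotient is `-1/(8(n+2))`.
  rw [casimir_eq_sum ρ (κ := Option (Idx n) × Option (Idx n))
    (fun α => (-1 / (8 * (n + 2)) : ℝ) • ∑ c, ∑ d, (omega n α.1 c * omega n α.2 d) • spGen c d)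
    (fun α => spGen α.1 α.2)]
  · simp only [Fintype.sum_prod_type, map_smul, map_sum, mul_smul_comm, Finset.mul_sum,
      Finset.smul_sum]
  · have : ∑ α : Option (Idx n) × Option (Idx n), (killingForm ℝ (sp n)
        ((-1 / (8 * (n + 2)) : ℝ) • ∑ c, ∑ d, (omega n α.1 c * omega n α.2 d) •
          spGen c d)).smulRight (spGen α.1 α.2) = LinearMap.id := by
      refine sp_hom_ext fun e f => ?_
      simp only [LinearMap.sum_apply, LinearMap.smulRight_apply, LinearMap.id_apply, map_smul,
        map_sum, LinearMap.smul_apply, smul_eq_mul, hK]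
      rw [Fintype.sum_prod_type]
      have hc : ∀ t : ℝ, (-1 / (8 * (n + 2)) : ℝ) * (-(4 * (n + 2)) * t) = 1 / 2 * t := fun t => by
        field_simp
        norm_num
      simp only [hc]
      simp only [mul_add, add_smul, Finset.sum_add_distrib, mul_smul,
        ite_smul, one_smul, zero_smul, Finset.sum_ite_eq', Finset.mem_univ,
        if_true, smul_ite, smul_zero]
      rw [spGen_comm f e]
      module
    intro x
    simpa [LinearMap.sum_apply] using LinearMap.congr_fun this x

end Killing

/-! ### Diagonalization of the Casimir operator by powers of `X`. -/

section Decomposition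

variable {n : ℕ}

/-- Contraction with the contact form, times `-2`. -/
noncomputable def opContr (n : ℕ) : Module.End ℝ (Pol n) := homContr (omega n) opX opEta

/-- The generalized contact Hamiltonian with parameter `lam`. -/
noncomputable def opHam (n : ℕ) (lam : ℝ) : Module.End ℝ (Pol n) :=
  homHam (omega n) (opNab lam) opXi

/-- The Lie derivative along the Hamiltonian field of `x_a x_b` with parameter `lam`. -/
noncomputable def opLie (n : ℕ) (lam : ℝ) (a b : Option (Idx n)) : Module.End ℝ (Pol n) :=
  quadLie (omega n) opX (opNab lam) opXi opEta a b

/-- The parameter `2(n+1)w - k` of the module `R^k_δ`. -/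
noncomputable def param (n k : ℕ) (δ : ℝ) : ℝ := 2 * (n + 1) * δ + k

theorem param_eq (n k : ℕ) (δ : ℝ) : 2 * (n + 1) * weight n k δ - k = param n k δ := by
  rw [weight, param]
  field_simp
  ring

theorem param_succ (n k : ℕ) (δ : ℝ) : param n (k + 1) δ - 1 = param n k δ := by
  rw [param, param]
  push_cast
  ring

/-- Source of all weight shifts: only `∂_none` depends on `lam`. It turns the correction terms of
the abstract commutation rules into a change of `lam` by one. -/
theorem opNab_sub_one (lam : ℝ) (a : Option (Idx n)) :
    opNab (lam - 1) a = opNab lam a + if a = none then 1 else 0 := by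
  rcases a with _ | i
  · simp only [opNab, if_true]
    module
  · simp [opNab]

theorem opHam_sub_one (lam : ℝ) :
    opHam n (lam - 1) = opHam n lam + raise (omega n) opXi none := by
  simp only [opHam, homHam, opNab_sub_one, mul_add, Finset.sum_add_distrib, mul_ite, mul_one,
    mul_zero, Finset.sum_ite_eq', Finset.mem_univ, if_true]

theorem opLie_sub_one (lam : ℝ) (a b : Option (Idx n)) :
    opLie n (lam - 1) a b = opLie n lam a b
      + (omega n b none • opX a + omega n a none • opX b) := by
  have : ∀ b, raise (omega n) (opNab (lam - 1)) b
      = raise (omega n) (opNab lam) b + omega n b none • 1 := fun b => by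
    simp only [raise, opNab_sub_one, smul_add, Finset.sum_add_distrib, smul_ite, smul_zero,
      Finset.sum_ite_eq', Finset.mem_univ, if_true]
  simp only [opLie, quadLie, this, mul_add, mul_smul_comm, mul_one]
  abel

/-- The contraction intertwines the actions with parameters `lam` and `lam - 1`, and `opHam n (lam -
1)` intertwines them in the opposite direction, so the two corrections cancel in the composite. -/
theorem opLie_mul_opHam_mul_opContr (lam : ℝ) (a b : Option (Idx n)) :
    opLie n lam a b * (opHam n (lam - 1) * opContr n)
      = opHam n (lam - 1) * opContr n * opLie n lam a b := by
  have h1 := (homogWeyl_op n lam).quadLie_homContr (isSymplectic_omega n) a b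
  have h2 := (homogWeyl_op n (lam - 1)).quadLie_homHam (isSymplectic_omega n) a b
  change opLie n lam a b * opContr n = opContr n * opLie n lam a b - _ * opContr n at h1
  change opLie n (lam - 1) a b * opHam n (lam - 1) = opHam n (lam - 1) * opLie n (lam - 1) a b
    + _ * opHam n (lam - 1) at h2
  rw [← mul_assoc]
  have h3 : opLie n lam a b * opHam n (lam - 1) = opHam n (lam - 1) * opLie n (lam - 1) a b := by
    rw [opLie_sub_one, add_mul] at h2
    rw [opLie_sub_one]
    exact add_right_cancel h2
  rw [h3, mul_assoc, opLie_sub_one, add_mul, h1, sub_add_cancel, mul_assoc]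

theorem sum_opXi_mul_opEta {k : ℕ} {P : Pol n} (hP : P ∈ Symb n k) :
    (∑ c, opXi c * opEta c : Module.End ℝ (Pol n)) P = (k : ℝ) • P := by
  rw [← sum_xi_mul_dxi hP, Fintype.sum_option]
  simp only [LinearMap.add_apply, LinearMap.sum_apply, Module.End.mul_apply, opEta_none_apply,
    map_zero, zero_add, opEta_some_apply, opXi_some_apply]

/-- The sl₂-type relation. The scalar is the fibre degree `k`, the value of the Euler operator, plus
the Euler constant `lam` of the base. -/
theorem opContr_opHam (lam : ℝ) {k : ℕ} {P : Pol n} (hP : P ∈ Symb n k) :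
    opContr n (opHam n lam P) = opHam n (lam - 1) (opContr n P) + (k + lam) • P := by
  have h := LinearMap.congr_fun
    ((homogWeyl_op n lam).homContr_homHam (isSymplectic_omega n)) P
  change opContr n (opHam n lam P) = (opHam n lam + raise (omega n) opXi none) (opContr n P)
    + (∑ c, opXi c * opEta c : Module.End ℝ (Pol n)) P + lam • P at h
  rw [h, sum_opXi_mul_opEta hP, ← opHam_sub_one, add_smul, add_assoc]

theorem opContr_apply (P : Pol n) : opContr n P
    = dxi it P - ∑ j : Fin n, (cst (coord (ip j)) * dxi (iq j) P
      - cst (coord (iq j)) * dxi (ip j) P) := by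
  simp [opContr, homContr, raise, LinearMap.sum_apply, Fintype.sum_option, omega, opX_apply,
    opEta_some_apply, opEta_none_apply, xhat]
  abel

theorem coe_iAlpha {k : ℕ} (P : Symb n k) :
    (iAlpha n k P : Pol n) = (-1 / 2 : ℝ) • opContr n P := by
  rw [opContr_apply]
  change (1 / 2 : ℝ) • _ = _
  module

theorem opHam_apply (lam : ℝ) (P : Pol n) : opHam n lam P
    = (∑ j : Fin n, (xi (iq j) * onCoeff (pd (ip j)) P - xi (ip j) * onCoeff (pd (iq j)) P))
      + xi it * onCoeff (eulerS n) P
      - (∑ j : Fin n, (cst (coord (ip j)) * (xi (ip j) * onCoeff (pd it) P)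
        + cst (coord (iq j)) * (xi (iq j) * onCoeff (pd it) P)))
      + lam • (xi it * (P : Pol n)) := by
  have h1 : onCoeff (eulerS n) P = ∑ j : Fin n, (cst (coord (ip j)) * onCoeff (pd (ip j)) P
      + cst (coord (iq j)) * onCoeff (pd (iq j)) P) := by
    simp only [eulerS, map_sum, map_add, LinearMap.sum_apply, LinearMap.add_apply,
      onCoeff_smul_field]
  rw [h1]
  simp [opHam, homHam, raise, LinearMap.sum_apply, Fintype.sum_option, omega,
    opXi_some_apply, opXi_none_apply, opNab_some_apply, opNab_none_apply, Finset.sum_add_distrib,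
    mul_add, mul_sub, Finset.mul_sum]
  ring_nf

theorem coe_genHam {k : ℕ} (w : ℝ) (P : Symb n k) :
    (genHam n k w P : Pol n) = opHam n (2 * (n + 1) * w - k) P := by
  rw [opHam_apply]
  rfl

theorem opContr_mem {k : ℕ} {P : Pol n} (hP : P ∈ Symb n k) :
    opContr n P ∈ Symb n (k - 1) := by
  rw [opContr_apply]
  exact sub_mem (dxi_mem _ hP) (sum_mem fun j _ => sub_mem (cst_mul_mem _ (dxi_mem _ hP))
    (cst_mul_mem _ (dxi_mem _ hP)))

theorem opContr_eq_zero_of_mem {P : Pol n} (hP : P ∈ Symb n 0) : opContr n P = 0 := by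
  have h := mem_symb.1 hP
  rw [← MvPolynomial.totalDegree_zero_iff_isHomogeneous,
    MvPolynomial.totalDegree_eq_zero_iff_eq_C] at h
  rw [opContr_apply, h]
  simp [dxi]

/-- The powers of the generalized contact Hamiltonian. -/
noncomputable def opHamPow (n : ℕ) (δ : ℝ) (j : ℕ) : ℕ → Module.End ℝ (Pol n)
  | 0 => 1
  | ℓ + 1 => opHam n (param n (j + ℓ) δ) * opHamPow n δ j ℓ

theorem coe_genHamPow (j : ℕ) (δ : ℝ) (ℓ : ℕ) (P : Symb n j) :
    (genHamPow n j δ ℓ P : Pol n) = opHamPow n δ j ℓ P := by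
  induction ℓ with
  | zero => rfl
  | succ ℓ ih =>
    rw [genHamPow, LinearMap.comp_apply, coe_genHam, param_eq, ih]
    rfl

theorem opHamPow_mem (δ : ℝ) {j : ℕ} (ℓ : ℕ) {P : Pol n} (hP : P ∈ Symb n j) :
    opHamPow n δ j ℓ P ∈ Symb n (j + ℓ) := by
  rw [← coe_genHamPow j δ ℓ ⟨P, hP⟩]
  exact Subtype.prop _

/-- The contraction is commuted past one factor `X` at a time until it kills `P`. The coefficient is
the sum of the scalars `2(n+1)δ + 2(j+i)` over `0 ≤ i ≤ ℓ`. -/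
theorem opContr_opHamPow (δ : ℝ) {j : ℕ} (ℓ : ℕ) {P : Pol n} (hP : P ∈ Symb n j)
    (h0 : opContr n P = 0) :
    opContr n (opHamPow n δ j (ℓ + 1) P)
      = ((ℓ + 1) * (2 * (n + 1) * δ + 2 * j + ℓ)) • opHamPow n δ j ℓ P := by
  induction ℓ with
  | zero =>
    change opContr n (opHam n (param n (j + 0) δ) P) = _ • P
    rw [opContr_opHam _ hP, h0, map_zero, zero_add, param]
    congr 1
    push_cast
    ring
  | succ ℓ ih =>
    have h1 : opHamPow n δ j (ℓ + 1 + 1) P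
        = opHam n (param n (j + (ℓ + 1)) δ) (opHamPow n δ j (ℓ + 1) P) := rfl
    have h2 : opHamPow n δ j (ℓ + 1) P
        = opHam n (param n (j + ℓ) δ) (opHamPow n δ j ℓ P) := rfl
    rw [h1, opContr_opHam _ (opHamPow_mem δ (ℓ + 1) hP), ih, map_smul, ← add_assoc, param_succ,
      ← h2, ← add_smul, param]
    congr 1
    push_cast
    ring

/-- The component `X^ℓ (R^{k-ℓ}_δ ∩ ker i_α)`, as a space of polynomials. -/
noncomputable def component (n : ℕ) (δ : ℝ) (k ℓ : ℕ) : Submodule ℝ (Pol n) :=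
  (Symb n (k - ℓ) ⊓ LinearMap.ker (opContr n)).map (opHamPow n δ (k - ℓ) ℓ)

theorem mem_subR {k ℓ : ℕ} {δ : ℝ} {S : Symb n k} :
    S ∈ subR n k δ ℓ ↔ (S : Pol n) ∈ component n δ k ℓ := by
  rw [subR, Submodule.mem_comap, component, Submodule.mem_map, Submodule.mem_map]
  have hA : ∀ P : Symb n (k - ℓ), iAlpha n (k - ℓ) P = 0 ↔ opContr n P = 0 := fun P => by
    rw [← Subtype.coe_inj, coe_iAlpha]
    simp
  constructor
  · rintro ⟨P, hP, h⟩
    refine ⟨P, ⟨P.2, (hA P).1 hP⟩, ?_⟩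
    rw [← coe_genHamPow]
    exact h
  · rintro ⟨P, ⟨h1, h2⟩, h⟩
    refine ⟨⟨P, h1⟩, (hA ⟨P, h1⟩).2 h2, ?_⟩
    rw [LinearMap.comp_apply, Submodule.subtype_apply, coe_genHamPow]
    exact h

/-- The operator on polynomials that restricts to the Casimir operator of `R^k_δ`. -/
noncomputable def opCas (n k : ℕ) (δ : ℝ) : Module.End ℝ (Pol n) :=
  eigenval n k δ 0 • 1 - (1 / (2 * (n + 2)) : ℝ) • (opHam n (param n k δ - 1) * opContr n)

/-- For `ℓ = 0` the contraction vanishes and only the scalar part of `opCas` acts; for larger `ℓ`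
the preceding coefficient supplies the difference of the eigenvalues. -/
theorem component_le_eigenspace {k ℓ : ℕ} (δ : ℝ) (h : ℓ ≤ k) :
    component n δ k ℓ ≤ Module.End.eigenspace (opCas n k δ) (eigenval n k δ ℓ) := by
  obtain ⟨j, rfl⟩ := Nat.exists_eq_add_of_le' h
  rintro _ ⟨P, ⟨hP, h0⟩, rfl⟩
  rw [Nat.add_sub_cancel] at *
  rw [Module.End.mem_eigenspace_iff]
  replace h0 : opContr n P = 0 := h0
  have hn : (n + 2 : ℝ) ≠ 0 := by positivity
  rcases ℓ with _ | ℓ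
  · change opCas n j δ P = _ • P
    simp [opCas, h0]
  · have h1 : opHamPow n δ j (ℓ + 1) P
        = opHam n (param n (j + ℓ) δ) (opHamPow n δ j ℓ P) := rfl
    rw [opCas, LinearMap.sub_apply, LinearMap.smul_apply, LinearMap.smul_apply,
      Module.End.mul_apply, opContr_opHamPow δ ℓ hP h0, map_smul, ← add_assoc, param_succ, ← h1,
      Module.End.one_apply, smul_smul, ← sub_smul]
    congr 1
    simp only [eigenval]
    push_cast
    field_simp
    ring

theorem coe_lieR_spGen {k : ℕ} (δ : ℝ) (a b : Option (Idx n)) (P : Symb n k) :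
    (lieR n k δ (spGen a b : sp n) P : Pol n) = opLie n (param n k δ) a b P := by
  rw [opLie, ← param_eq, ← lieTotal_contactField (weight n k δ) P.2 a b]
  rfl

/-- The abstract Casimir formula is specialized to `2n+2` coordinates and Euler eigenvalue `k`. The
term `raise om xi o` is absorbed by lowering the parameter of `X` by one, and the scalars sum to
`eigenval n k δ 0`. -/
theorem coe_casimirR {k : ℕ} (δ : ℝ) (P : Symb n k) :
    (casimirR n k δ P : Pol n) = opCas n k δ P := by
  have h := LinearMap.congr_fun
    ((homogWeyl_op n (param n k δ)).sum_quadLie_mul_quadLie (isSymplectic_omega n)) (P : Pol n)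
  have hE := sum_opXi_mul_opEta P.2
  have hcard : (Fintype.card (Option (Idx n)) : ℝ) = 2 * n + 2 := by
    simp
    ring
  simp only [LinearMap.sub_apply, LinearMap.add_apply, LinearMap.smul_apply, Module.End.mul_apply,
    Module.End.one_apply, hE, map_smul, hcard] at h
  have h' : ((∑ a, ∑ b, ∑ c, ∑ d, (omega n a c * omega n b d) •
      (lieR n k δ (spGen a b : sp n) * lieR n k δ (spGen c d : sp n)) : Module.End ℝ (Symb n k)) P
        : Pol n) = (∑ a, ∑ b, ∑ c, ∑ d, (omega n a c * omega n b d) •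
          (opLie n (param n k δ) a b * opLie n (param n k δ) c d) : Module.End ℝ (Pol n)) P := by
    simp only [LinearMap.sum_apply, LinearMap.smul_apply, Module.End.mul_apply,
      Submodule.coe_sum, Submodule.coe_smul, coe_lieR_spGen]
  rw [casimirR, casimir_sp]
  change (-1 / (8 * (n + 2)) : ℝ) • ((∑ a, ∑ b, ∑ c, ∑ d, (omega n a c * omega n b d) •
      (lieR n k δ (spGen a b : sp n) * lieR n k δ (spGen c d : sp n)) : Module.End ℝ (Symb n k)) P
        : Pol n) = _
  rw [h'.trans h, opCas, opHam_sub_one]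
  change _ = eigenval n k δ 0 • (P : Pol n) - (1 / (2 * (n + 2)) : ℝ) •
    ((homHam (omega n) (opNab (param n k δ)) opXi (homContr (omega n) opX opEta (P : Pol n))
      + raise (omega n) opXi none (homContr (omega n) opX opEta (P : Pol n))))
  have hn : (n + 2 : ℝ) ≠ 0 := by positivity
  simp only [eigenval, param]
  match_scalars <;> field_simp <;> ring

/-- By linearity it is enough to treat the generators, where only the composite `X ∘ i_α` has to
commute with the action. -/
theorem casimirR_lieR {k : ℕ} (δ : ℝ) {D : Vect n} (hD : D ∈ sp n) (P : Symb n k) :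
    casimirR n k δ (lieR n k δ D P) = lieR n k δ D (casimirR n k δ P) := by
  have key : (LinearMap.mulLeft ℝ (casimirR n k δ)).comp
        ((lieR n k δ).comp (sp n).toSubmodule.subtype : sp n →ₗ[ℝ] Module.End ℝ (Symb n k))
      = (LinearMap.mulRight ℝ (casimirR n k δ)).comp
        ((lieR n k δ).comp (sp n).toSubmodule.subtype : sp n →ₗ[ℝ] Module.End ℝ (Symb n k)) := by
    refine sp_hom_ext (V := Module.End ℝ (Symb n k)) fun a b => ?_
    refine LinearMap.ext fun P => Subtype.ext ?_
    change (casimirR n k δ (lieR n k δ (spGen a b : sp n) P) : Pol n)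
      = lieR n k δ (spGen a b : sp n) (casimirR n k δ P)
    have h := LinearMap.congr_fun (opLie_mul_opHam_mul_opContr (param n k δ) a b) (P : Pol n)
    simp only [Module.End.mul_apply] at h
    rw [coe_casimirR, coe_lieR_spGen, coe_lieR_spGen, coe_casimirR]
    simp only [opCas, LinearMap.sub_apply, LinearMap.smul_apply, Module.End.mul_apply,
      Module.End.one_apply, map_sub, map_smul, h]
  exact LinearMap.congr_fun (LinearMap.congr_fun key ⟨D, hD⟩) P

/-- By induction on the degree, the contraction of a symbol is a sum of terms `X^ℓ P` with `P` in
the kernel. Each is a nonzero multiple of the contraction of `X^(ℓ+1) P`, so subtracting these lifts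
leaves an element of the kernel. -/
theorem symb_le_iSup_component (δ : ℝ) (k : ℕ) (hδ : δ ∉ critical n k) :
    Symb n k ≤ ⨆ ℓ : Fin (k + 1), component n δ k ℓ := by
  induction k with
  | zero =>
    intro P hP
    exact Submodule.mem_iSup_of_mem 0 ⟨P, ⟨hP, opContr_eq_zero_of_mem hP⟩, rfl⟩
  | succ k ih =>
    intro S hS
    have hk : δ ∉ critical n k := fun ⟨p, hp, h⟩ => hδ ⟨p, by omega, h⟩
    have hle : ⨆ ℓ : Fin (k + 1), component n δ k ℓ
        ≤ (Symb n (k + 1) ⊓ ⨆ ℓ : Fin (k + 1 + 1), component n δ (k + 1) ℓ).map (opContr n) := by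
      refine iSup_le fun ℓ => ?_
      rintro _ ⟨P, ⟨hP, h0⟩, rfl⟩
      have hl : (ℓ : ℕ) ≤ k := Nat.lt_succ_iff.1 ℓ.2
      set c : ℝ := ((ℓ : ℕ) + 1) * (2 * (n + 1) * δ + 2 * ((k - ℓ : ℕ) : ℝ) + (ℓ : ℕ)) with hc
      have hc0 : c ≠ 0 := by
        -- A vanishing coefficient would give the critical value with `p = 2(k-ℓ) + ℓ ≤ 2k = 2(k+1)
        -- - 2`.
        refine mul_ne_zero (by positivity) fun h => hδ ⟨2 * (k - ℓ) + ℓ, by omega, ?_⟩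
        push_cast
        field_simp
        linarith
      refine ⟨c⁻¹ • opHamPow n δ (k - ℓ) (ℓ + 1) P, ⟨?_, ?_⟩, ?_⟩
      · refine Submodule.smul_mem _ _ ?_
        have := opHamPow_mem δ ((ℓ : ℕ) + 1) hP
        rwa [← add_assoc, Nat.sub_add_cancel hl] at this
      · refine Submodule.smul_mem _ _ (Submodule.mem_iSup_of_mem ℓ.succ ?_)
        rw [Fin.val_succ, component, Nat.add_sub_add_right]
        exact ⟨P, ⟨hP, h0⟩, rfl⟩
      · rw [map_smul, opContr_opHamPow δ _ hP h0, smul_smul, inv_mul_cancel₀ hc0, one_smul]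
    obtain ⟨S', ⟨h1, h2⟩, h3⟩ := hle (ih hk (opContr_mem hS))
    rw [← sub_add_cancel S S']
    refine add_mem (Submodule.mem_iSup_of_mem 0 ⟨S - S', ⟨sub_mem hS h1, ?_⟩, rfl⟩) h2
    rw [SetLike.mem_coe, LinearMap.mem_ker, map_sub, h3, sub_self]

theorem eigenval_injective {k : ℕ} {δ : ℝ} (hδ : δ ∉ critical n k) :
    Function.Injective fun ℓ : Fin (k + 1) => eigenval n k δ ℓ := by
  intro ℓ m h
  by_contra hne
  have hne' : (ℓ : ℕ) ≠ m := fun h => hne (Fin.ext h)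
  have hn : (n + 2 : ℝ) ≠ 0 := by positivity
  -- The eigenvalue is quadratic in `ℓ`, so the difference of two of its values has the factor `ℓ -
  -- m`.
  have h1 : ((ℓ : ℕ) - (m : ℕ) : ℝ) * (2 * (n + 1) * δ + 2 * k - 1 - (ℓ : ℕ) - (m : ℕ)) = 0 := by
    simp only [eigenval] at h
    have h2 := mul_left_cancel₀ (one_div_ne_zero hn) h
    linarith
  rcases mul_eq_zero.1 h1 with h2 | h2
  · exact hne' (by exact_mod_cast sub_eq_zero.1 h2)
  · have hl := ℓ.2
    have hm := m.2
    -- Since `ℓ ≠ m` and both are at most `k`, one has `1 ≤ ℓ + m ≤ 2k - 1`: the natural subtraction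
    -- does not truncate, and `p ≤ 2k - 2`.
    refine hδ ⟨2 * k - 1 - ℓ - m, by omega, ?_⟩
    have h3 : ((2 * k - 1 - ℓ - m : ℕ) : ℝ) = 2 * k - 1 - (ℓ : ℕ) - (m : ℕ) := by
      rw [eq_sub_iff_add_eq, eq_sub_iff_add_eq, eq_sub_iff_add_eq]
      have : 2 * k - 1 - ℓ - m + m + ℓ + 1 = 2 * k := by omega
      exact_mod_cast this
    rw [h3]
    field_simp
    linarith

end Decomposition

/-! ### Eigenspaces and intertwining operators. -/

theorem exists_mem_of_mem_eigenspace {V ι : Type*} [AddCommGroup V] [Module ℝ V] [Fintype ι]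
    (f : Module.End ℝ V) {μ : ι → ℝ} (hμ : Function.Injective μ) {W : ι → Submodule ℝ V}
    (hW : ∀ i, W i ≤ Module.End.eigenspace f (μ i)) {S : V} (hS : S ∈ ⨆ i, W i) (h0 : S ≠ 0)
    {ν : ℝ} (h : S ∈ Module.End.eigenspace f ν) : ∃ i, μ i = ν ∧ S ∈ W i := by
  classical
  obtain ⟨v, hv, rfl⟩ := (Submodule.mem_iSup_iff_exists_finsupp _ _).1 hS
  have hsum : (v.sum fun _ x => x) = ∑ i, v i := Finsupp.sum_fintype _ _ fun _ => rfl
  rw [hsum] at h h0 ⊢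
  -- Applying `f - ν` to the decomposition of the vector gives `∑ (μ i - ν) v i = 0`; independence
  -- of the eigenspaces kills every component with `μ i ≠ ν`.
  have hind := (iSupIndep_iff_finsetSum_eq_zero_imp_eq_zero _).1
    ((Module.End.eigenspaces_iSupIndep f).comp hμ) Finset.univ (fun i => (μ i - ν) • v i)
    (fun i _ => Submodule.smul_mem _ _ (hW i (hv i))) (by
      have h1 : ∀ i, f (v i) = μ i • v i := fun i =>
        Module.End.mem_eigenspace_iff.1 (hW i (hv i))
      have h2 := Module.End.mem_eigenspace_iff.1 h
      rw [map_sum, Finset.smul_sum] at h2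
      simp only [h1] at h2
      simp only [sub_smul, Finset.sum_sub_distrib, h2, sub_self])
  have hzero : ∀ i, μ i ≠ ν → v i = 0 := fun i hi =>
    (smul_eq_zero.1 (hind i (Finset.mem_univ i))).resolve_left (sub_ne_zero.2 hi)
  obtain ⟨i, -, hi⟩ := Finset.exists_ne_zero_of_sum_ne_zero h0
  have hiν : μ i = ν := by_contra fun hne => hi (hzero i hne)
  refine ⟨i, hiν, ?_⟩
  rw [Finset.sum_eq_single i (fun j _ hj => hzero j fun hjν => hj (hμ (hjν.trans hiν.symm)))
    (fun hni => absurd (Finset.mem_univ i) hni)]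
  exact hv i

/-- Both Casimir operators come from the same quadratic expression in the Lie algebra, with the same
basis and coefficients, so `T` passes through factor by factor. -/
theorem casimir_intertwine {𝔤 M M' : Type*} [LieRing 𝔤] [LieAlgebra ℝ 𝔤] [Module.Finite ℝ 𝔤]
    [AddCommGroup M] [Module ℝ M] [AddCommGroup M'] [Module ℝ M'] (ρ : 𝔤 →ₗ[ℝ] Module.End ℝ M)
    (ρ' : 𝔤 →ₗ[ℝ] Module.End ℝ M') (T : M →ₗ[ℝ] M') (hT : ∀ x m, T (ρ x m) = ρ' x (T m)) (m : M) :
    T (casimir ρ m) = casimir ρ' (T m) := by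
  simp only [casimir, LinearMap.sum_apply, map_sum, Module.End.mul_apply, hT]

variable {n : ℕ}

theorem exists_mem_subR_of_mem_eigenspace {k : ℕ} {δ : ℝ} (hδ : δ ∉ critical n k) {ν : ℝ}
    {S : Symb n k} (h0 : S ≠ 0) (h : S ∈ Module.End.eigenspace (casimirR n k δ) ν) :
    ∃ ℓ : Fin (k + 1), eigenval n k δ ℓ = ν ∧ S ∈ subR n k δ ℓ := by
  simp only [mem_subR]
  refine exists_mem_of_mem_eigenspace (opCas n k δ) (eigenval_injective hδ)
    (fun ℓ => component_le_eigenspace δ (Nat.lt_succ_iff.1 ℓ.2))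
    (symb_le_iSup_component δ k hδ S.2) (fun h => h0 (Subtype.ext h)) ?_
  rw [Module.End.mem_eigenspace_iff] at h ⊢
  rw [← coe_casimirR, h]
  rfl

/-- One inclusion is the eigenvalue computation. For the other, the full decomposition puts a
nonzero eigenvector into some component, and distinctness of the eigenvalues identifies which. -/
theorem subR_eq_eigenspace {k : ℕ} {δ : ℝ} (hδ : δ ∉ critical n k) (ℓ : Fin (k + 1)) :
    subR n k δ ℓ = Module.End.eigenspace (casimirR n k δ) (eigenval n k δ ℓ) := by
  ext S
  constructor
  · intro hS
    have := component_le_eigenspace δ (Nat.lt_succ_iff.1 ℓ.2) (mem_subR.1 hS)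
    rw [Module.End.mem_eigenspace_iff] at this ⊢
    refine Subtype.ext ?_
    rw [coe_casimirR, this]
    rfl
  · intro hS
    by_cases h0 : S = 0
    · rw [h0]; exact zero_mem _
    · obtain ⟨m, hm, hmS⟩ := exists_mem_subR_of_mem_eigenspace hδ h0 hS
      rwa [← eigenval_injective hδ hm]

theorem lieR_mem_subR {k : ℕ} {δ : ℝ} (hδ : δ ∉ critical n k) (ℓ : Fin (k + 1)) {D : Vect n}
    (hD : D ∈ sp n) {P : Symb n k} (hP : P ∈ subR n k δ ℓ) : lieR n k δ D P ∈ subR n k δ ℓ := by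
  rw [subR_eq_eigenspace hδ, Module.End.mem_eigenspace_iff] at *
  rw [casimirR_lieR δ hD, hP, map_smul]

end ContactSymbols

theorem mainTheorem6 (n k k' : ℕ) (δ δ' : ℝ) (hδ : δ ∉ critical n k) (hδ' : δ' ∉ critical n k')
    (T : Symb n k →ₗ[ℝ] Symb n k')
    (hT : ∀ D ∈ sp n, ∀ P : Symb n k, T (lieR n k δ D P) = lieR n k' δ' D (T P)) :
    -- the spaces `R^{k,ℓ}_δ` and `R^{k',ℓ'}_{δ'}` are Casimir eigenspaces and submodules
    (∀ ℓ : Fin (k + 1),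
      subR n k δ ℓ = Module.End.eigenspace (casimirR n k δ) (eigenval n k δ ℓ) ∧
      ∀ D ∈ sp n, ∀ P ∈ subR n k δ ℓ, lieR n k δ D P ∈ subR n k δ ℓ) ∧
    (∀ ℓ' : Fin (k' + 1),
      subR n k' δ' ℓ' = Module.End.eigenspace (casimirR n k' δ') (eigenval n k' δ' ℓ') ∧
      ∀ D ∈ sp n, ∀ P ∈ subR n k' δ' ℓ', lieR n k' δ' D P ∈ subR n k' δ' ℓ') ∧
    -- the map `ℓ ↦ ℓ'`, defined for those `ℓ` for which `T` does not vanish on `R^{k,ℓ}_δ`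
    ∃ φ : {ℓ : Fin (k + 1) // ¬ ∀ P ∈ subR n k δ ℓ, T P = 0} → Fin (k' + 1),
      (∀ ℓ, (∀ P ∈ subR n k δ ℓ.1, T P ∈ subR n k' δ' (φ ℓ)) ∧
        eigenval n k' δ' (φ ℓ) = eigenval n k δ ℓ.1 ∧
        (∀ m : Fin (k' + 1), (∀ P ∈ subR n k δ ℓ.1, T P ∈ subR n k' δ' m) → m = φ ℓ) ∧
        (∀ m : Fin (k' + 1), eigenval n k' δ' m = eigenval n k δ ℓ.1 → m = φ ℓ)) ∧
      Function.Injective φ := by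
  have hTC : ∀ (ℓ : Fin (k + 1)), ∀ P ∈ subR n k δ ℓ,
      T P ∈ Module.End.eigenspace (casimirR n k' δ') (eigenval n k δ ℓ) := fun ℓ P hP => by
    rw [subR_eq_eigenspace hδ, Module.End.mem_eigenspace_iff] at hP
    rw [Module.End.mem_eigenspace_iff, ← map_smul, ← hP]
    exact (casimir_intertwine
      ((lieR n k δ).comp (sp n).toSubmodule.subtype : sp n →ₗ[ℝ] Module.End ℝ (Symb n k))
      ((lieR n k' δ').comp (sp n).toSubmodule.subtype : sp n →ₗ[ℝ] Module.End ℝ (Symb n k'))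
      T (fun x P => hT x.1 x.2 P) P).symm
  -- A nonzero value of `T` is an eigenvector in the target, and the target has no eigenvalues other
  -- than the `eigenval n k' δ' m`.
  have hex : ∀ ℓ : {ℓ : Fin (k + 1) // ¬ ∀ P ∈ subR n k δ ℓ, T P = 0},
      ∃ m : Fin (k' + 1), eigenval n k' δ' m = eigenval n k δ ℓ.1 := fun ℓ => by
    obtain ⟨P, hP, h0⟩ := not_forall₂.1 ℓ.2
    obtain ⟨m, hm, -⟩ := exists_mem_subR_of_mem_eigenspace hδ' h0 (hTC ℓ.1 P hP)
    exact ⟨m, hm⟩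
  choose φ hφ using hex
  refine ⟨fun ℓ => ⟨subR_eq_eigenspace hδ ℓ, fun D hD P hP => lieR_mem_subR hδ ℓ hD hP⟩,
    fun ℓ => ⟨subR_eq_eigenspace hδ' ℓ, fun D hD P hP => lieR_mem_subR hδ' ℓ hD hP⟩, φ,
    fun ℓ => ⟨fun P hP => ?_, hφ ℓ, fun m hm => ?_, fun m hm => ?_⟩, fun ℓ m h => ?_⟩
  · rw [subR_eq_eigenspace hδ', hφ]
    exact hTC ℓ.1 P hP
  -- A nonzero `T P` in two components would have two eigenvalues.
  · obtain ⟨P, hP, h0⟩ := not_forall₂.1 ℓ.2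
    have h1 := hm P hP
    have h2 := hTC ℓ.1 P hP
    rw [subR_eq_eigenspace hδ', Module.End.mem_eigenspace_iff] at h1
    rw [Module.End.mem_eigenspace_iff, h1, ← hφ] at h2
    exact eigenval_injective hδ' (smul_left_injective ℝ h0 h2)
  · exact eigenval_injective hδ' (hm.trans (hφ ℓ).symm)
  -- Equal targets have equal eigenvalues, hence so do the sources, where the eigenvalues are again
  -- distinct.
  · refine Subtype.ext (eigenval_injective hδ ?_)
    change eigenval n k δ ℓ.1 = eigenval n k δ m.1
    rw [← hφ, ← hφ, h]
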